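/- **Conventions.** Let $\Gamma$ be a (small) groupoid, identified with its set of morphisms, and let $\Gamma_0$ be its set of objects, each $e\in\Gamma_0$ being identified with its identity morphism. For $\gamma\in\Gamma$ let $d(\gamma)$ and $r(\gamma)$ be its domain and codomain; $\sigma\gamma$ is defined exactly when $d(\sigma)=r(\gamma)$. For $e\in\Gamma_0$ put $e\Gamma=\{\gamma: r(\gamma)=e\}$ and $e\Gamma e=\{\gamma: r(\gamma)=d(\gamma)=e\}$. Rings are associative, not necessarily unital. A *$\Gamma$-graded ring* here is always object unital: a ring $R=\bigoplus_{\gamma\in\Gamma}R_\gamma$ with additive subgroups $R_\gamma$ such that $R_\gamma R_\delta\subseteq R_{\gamma\delta}$ (with $R_{\gamma\delta}:=0$ if $\gamma\delta$ is not defined), and such that for each $e\in\Gamma_0$ there is $1_e\in R_e$ with $1_{r(\gamma)}a=a=a1_{d(\gamma)}$ for all $\gamma\in\Gamma$, $a\in R_\gamma$. Write $\operatorname{supp}R=\{\gamma:R_\gamma\ne0\}$ and $\Gamma_0'(R)=\{e\in\Gamma_0:1_e\neq0\}$. A *gr-isomorphism* $R\cong_{gr}S$ is a ring isomorphism mapping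 $R_\gamma$ into $S_\gamma$ for all $\gamma$ and $1_e$ to $1_e$ for all $e$. A (one- or two-sided) ideal $N$ is *graded* if $N=\bigoplus_\gamma (N\cap R_\gamma)$. * $R$ is *right (left) gr-semisimple* if $R$ is a sum of minimal nonzero graded right (left) ideals. * $R$ is *right (left) $\Gamma_0$-artinian* if for each $e\in\Gamma_0$ the graded right ideals of $R$ contained in $\bigoplus_{r(\gamma)=e}R_\gamma$ (the graded left ideals contained in $\bigoplus_{d(\gamma)=e}R_\gamma$) satisfy the descending chain condition. * $R$ is *gr-simple* if $R\ne0$ and its only graded ideals are $0$ and $R$; it is *gr-prime* if $IJ\neq0$ for all nonzero graded ideals $I,J$. * $R$ is a *gr-division ring* if $R\neq 0$ and for all $\gamma$ and all $0\ne a\in R_\gamma$ there is $b\in R_{\gamma^{-1}}$ with $ab=1_{r(\gamma)}$ and $ba=1_{d(\gamma)}$. * For a family $(R_j)_{j\in J}$ of $\Gamma$-graded rings, $\prod^{gr}_{j}R_j:=\bigoplus_{\gamma}\prod_{j}(R_j)_\gamma\subseteq \prod_j R_j$; the family is *summable* if $\prod^{gr}_jR_j=\bigoplus_jR_j$. * A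 sequence $\overline\Sigma=(\Sigma_i)_{i\in I}$ of nonempty subsets of $\Gamma$, $I\ne\emptyset$, is *$d$-finite* if for each $e\in\Gamma_0$ only finitely many $i\in I$ admit some $\sigma\in\Sigma_i$ with $d(\sigma)=e$. It is *matricial for $D$* if it is $d$-finite and, for each $i$, the maps $d$ and $r$ are injective on $\Sigma_i$ and $r(\Sigma_i)\subseteq\Gamma'_0(D)$. A sequence $(\sigma_i)_{i\in I}$ of elements of $\Gamma$ is regarded as the sequence of the singletons $\{\sigma_i\}$. * If $\overline\Sigma$ is matricial for $D$, then $\mathbb M_I(D)(\overline\Sigma):=\bigoplus_\gamma \mathbb M_I(D)(\overline\Sigma)_\gamma$, where $\mathbb M_I(D)(\overline\Sigma)_\gamma$ consists of the $I\times I$ matrices $(a_{ij})$ with finitely many nonzero entries such that $a_{ij}\in D_{\sigma\gamma\tau^{-1}}$ if there are (necessarily unique) $\sigma\in\Sigma_i$, $\tau\in\Sigma_j$ with $d(\sigma)=r(\gamma)$ and $d(\tau)=d(\gamma)$, and $a_{ij}=0$ otherwise. With matrix multiplication it is a $\Gamma$-graded ring. If $D$ is a gr-division ring with $\operatorname{supp}D\subseteq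 e\Gamma e$, every $d$-finite sequence in $e\Gamma$ is matricial for $D$. **Theorem.** For a $\Gamma$-graded ring $R$ the following statements are equivalent. 1. $R$ is gr-semisimple, in either of the equivalent senses: (1r) $R$ is right gr-semisimple; (1l) $R$ is left gr-semisimple. 2. There exist a set $J$, a family $(e_j)_{j\in J}$ in $\Gamma_0$ and, for each $j\in J$, a $\Gamma$-graded gr-division ring $D_j$ with $\operatorname{supp}(D_j)\subseteq e_j\Gamma e_j$, a nonempty set $K_j$ and a $d$-finite sequence $\overline\sigma_j=(\sigma_{jk})_{k\in K_j}\in(e_j\Gamma)^{K_j}$ such that the family $\{\mathbb M_{K_j}(D_j)(\overline\sigma_j):j\in J\}$ is summable and $R\cong_{gr}\prod^{gr}_{j\in J}\mathbb M_{K_j}(D_j)(\overline\sigma_j)$. 3. There exist a set $J$ and, for each $j\in J$, a gr-prime $\Gamma$-graded gr-division ring $D_j$ and a matricial sequence $\overline\Sigma_j=(\Sigma_{jk})_{k\in K_j}$ of subsets of $\Gamma$ for $D_j$ such that the family $\{\mathbb M_{K_j}(D_j)(\overline\Sigma_j):j\in J\}$ is summable and $R\cong_{gr}\prod^{gr}_{j\in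 J}\mathbb M_{K_j}(D_j)(\overline\Sigma_j)$. 4. There exists a summable family $\{R_j:j\in J\}$ of gr-simple $\Gamma_0$-artinian $\Gamma$-graded rings such that $R\cong_{gr}\prod^{gr}_{j\in J}R_j$, again in either of the equivalent senses: (4r) all $R_j$ are right $\Gamma_0$-artinian; (4l) all $R_j$ are left $\Gamma_0$-artinian. (All six statements (1r), (1l), (2), (3), (4r), (4l) are equivalent. The set $J$ may be empty.) -/

import Mathlib

open CategoryTheory

universe u v w

namespace GroupoidGraded

/-! ### Groupoids -/

/-- The morphisms of a groupoid `Γ` (whose type of objects is also called `Γ`), all collected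
in one type.  `γ.d` and `γ.r` are the domain and the codomain of `γ`.  The product `σγ` of the
mathematical text, defined when `d(σ) = r(γ)`, is `γ ≫ σ` in Mathlib's notation. -/
structure GMor (Γ : Type u) [Groupoid.{v} Γ] where
  {d r : Γ}
  hom : d ⟶ r

variable {Γ : Type u} [Groupoid.{v} Γ]

/-! ### Graded rings -/

/-- An object unital `Γ`-graded ring: an associative, not necessarily unital ring
`R = ⨁_γ R_γ` with `R_γ R_δ ⊆ R_{γδ}` (where `R_{γδ} = 0` if `γδ` is not defined), such that
for every object `e` there is `1_e ∈ R_e` with `1_{r(γ)} a = a = a 1_{d(γ)}` for `a ∈ R_γ`. -/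
structure GrRing (Γ : Type u) [Groupoid.{v} Γ] where
  carrier : Type w
  [ring : NonUnitalRing carrier]
  comp : GMor Γ → AddSubgroup carrier
  indep : iSupIndep comp
  iSup_comp : ⨆ γ, comp γ = ⊤
  mul_mem : ∀ {x y z : Γ} (γ : y ⟶ z) (δ : x ⟶ y) {a b : carrier},
    a ∈ comp ⟨γ⟩ → b ∈ comp ⟨δ⟩ → a * b ∈ comp ⟨δ ≫ γ⟩
  mul_eq_zero : ∀ (γ δ : GMor Γ) {a b : carrier}, γ.d ≠ δ.r →
    a ∈ comp γ → b ∈ comp δ → a * b = 0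
  one : Γ → carrier
  one_mem : ∀ e : Γ, one e ∈ comp ⟨𝟙 e⟩
  one_mul : ∀ (γ : GMor Γ) {a : carrier}, a ∈ comp γ → one γ.r * a = a
  mul_one : ∀ (γ : GMor Γ) {a : carrier}, a ∈ comp γ → a * one γ.d = a

attribute [instance] GrRing.ring

/-- `R ≅_gr S`: there is a bijective ring homomorphism `R → S` which maps `R_γ` into `S_γ` for
every `γ` and `1_e` to `1_e` for every object `e`. -/
def GrIso (R S : GrRing.{u, v, w} Γ) : Prop :=
  ∃ φ : R.carrier ≃+* S.carrier,
    (∀ γ, ∀ a ∈ R.comp γ, φ a ∈ S.comp γ) ∧ ∀ e, φ (R.one e) = S.one e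

namespace GrRing

variable (R : GrRing.{u, v, w} Γ)

/-- The support of a graded ring. -/
def supp : Set (GMor Γ) := {γ | R.comp γ ≠ ⊥}

/-- `Γ₀'(R)`: the objects `e` with `1_e ≠ 0`. -/
def objSupp : Set Γ := {e | R.one e ≠ 0}

/-! ### Graded ideals, gr-simple modules, semisimplicity and chain conditions -/

/-- An additive subgroup `N` is graded if `N = ⨁_γ (N ∩ R_γ)`. -/
def IsGraded (N : AddSubgroup R.carrier) : Prop := N = ⨆ γ, N ⊓ R.comp γ

/-- Graded right ideals, that is, graded submodules of `R_R`. -/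
structure IsGrRightIdeal (N : AddSubgroup R.carrier) : Prop where
  graded : R.IsGraded N
  mul_mem_right : ∀ x ∈ N, ∀ a : R.carrier, x * a ∈ N

/-- Graded left ideals, that is, graded submodules of the left module `R`. -/
structure IsGrLeftIdeal (N : AddSubgroup R.carrier) : Prop where
  graded : R.IsGraded N
  mul_mem_left : ∀ x ∈ N, ∀ a : R.carrier, a * x ∈ N

/-- Graded (two-sided) ideals. -/
def IsGrIdeal (N : AddSubgroup R.carrier) : Prop := R.IsGrRightIdeal N ∧ R.IsGrLeftIdeal N

/-- A graded submodule `S` of `R_R` which is gr-simple: it is nonzero, and its only graded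
submodules are `0` and `S`. -/
def IsGrSimpleRight (S : AddSubgroup R.carrier) : Prop :=
  R.IsGrRightIdeal S ∧ S ≠ ⊥ ∧ ∀ N ≤ S, R.IsGrRightIdeal N → N = ⊥ ∨ N = S

/-- A graded submodule `S` of the left module `R` which is gr-simple. -/
def IsGrSimpleLeft (S : AddSubgroup R.carrier) : Prop :=
  R.IsGrLeftIdeal S ∧ S ≠ ⊥ ∧ ∀ N ≤ S, R.IsGrLeftIdeal N → N = ⊥ ∨ N = S

/-- `R` is right gr-semisimple: `R_R` is a sum of gr-simple graded submodules. -/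
def IsRightGrSemisimple : Prop :=
  ∃ 𝒮 : Set (AddSubgroup R.carrier), (∀ S ∈ 𝒮, R.IsGrSimpleRight S) ∧ sSup 𝒮 = ⊤

/-- `R` is left gr-semisimple: the left module `R` is a sum of gr-simple graded submodules. -/
def IsLeftGrSemisimple : Prop :=
  ∃ 𝒮 : Set (AddSubgroup R.carrier), (∀ S ∈ 𝒮, R.IsGrSimpleLeft S) ∧ sSup 𝒮 = ⊤

/-- The right ideal `R(e) = ⨁_{r(γ) = e} R_γ`. -/
def rightPart (e : Γ) : AddSubgroup R.carrier := ⨆ (γ : GMor Γ) (_ : γ.r = e), R.comp γ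

/-- The left ideal `(e)R = ⨁_{d(γ) = e} R_γ`. -/
def leftPart (e : Γ) : AddSubgroup R.carrier := ⨆ (γ : GMor Γ) (_ : γ.d = e), R.comp γ

/-- `R` is right `Γ₀`-artinian: for every object `e`, the graded right module `R(e)` satisfies
the descending chain condition on graded submodules. -/
def IsRightArtinian : Prop :=
  ∀ (e : Γ) (N : ℕ → AddSubgroup R.carrier), Antitone N →
    (∀ n, R.IsGrRightIdeal (N n) ∧ N n ≤ R.rightPart e) → ∃ n, ∀ m, n ≤ m → N m = N n

/-- `R` is left `Γ₀`-artinian: for every object `e`, the graded left module `(e)R` satisfies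
the descending chain condition on graded submodules. -/
def IsLeftArtinian : Prop :=
  ∀ (e : Γ) (N : ℕ → AddSubgroup R.carrier), Antitone N →
    (∀ n, R.IsGrLeftIdeal (N n) ∧ N n ≤ R.leftPart e) → ∃ n, ∀ m, n ≤ m → N m = N n

/-- `R` is gr-simple: it is nonzero, and its only graded ideals are `0` and `R`. -/
def IsGrSimple : Prop :=
  Nontrivial R.carrier ∧ ∀ I, R.IsGrIdeal I → I = ⊥ ∨ I = ⊤

/-- `R` is gr-prime: `IJ ≠ 0` for all nonzero graded ideals `I` and `J`. -/
def IsGrPrime : Prop :=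
  ∀ I J, R.IsGrIdeal I → R.IsGrIdeal J → I ≠ ⊥ → J ≠ ⊥ → ∃ a ∈ I, ∃ b ∈ J, a * b ≠ 0

/-- `R` is a gr-division ring: it is nonzero, and every nonzero homogeneous `a ∈ R_γ` has an
inverse `b ∈ R_{γ⁻¹}`, meaning `ab = 1_{r(γ)}` and `ba = 1_{d(γ)}`. -/
def IsGrDivision : Prop :=
  Nontrivial R.carrier ∧ ∀ γ : GMor Γ, ∀ a ∈ R.comp γ, a ≠ 0 →
    ∃ b ∈ R.comp ⟨Groupoid.inv γ.hom⟩, a * b = R.one γ.r ∧ b * a = R.one γ.d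

end GrRing

/-! ### Two auxiliary facts -/

/-- Independence can be tested through a jointly injective family of homomorphisms. -/
theorem iSupIndep_of_maps {ι κ A : Type*} {B : κ → Type*} [AddCommGroup A]
    [∀ k, AddCommGroup (B k)] (C : ι → AddSubgroup A) (f : ∀ k, A →+ B k)
    (E : ∀ k, ι → AddSubgroup (B k)) (hE : ∀ k, iSupIndep (E k))
    (hf : ∀ a, (∀ k, f k a = 0) → a = 0)
    (h : ∀ k i, ∀ a ∈ C i, f k a ∈ E k i) : iSupIndep C := by
  intro i
  rw [AddSubgroup.disjoint_def]
  intro a ha ha'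
  refine hf a fun k => ?_
  refine (AddSubgroup.disjoint_def.1 (hE k i)) (h k i a ha) ?_
  have hle : (⨆ (j) (_ : j ≠ i), C j) ≤ (⨆ (j) (_ : j ≠ i), E k j).comap (f k) := by
    refine iSup₂_le fun j hj b hb => ?_
    exact (le_iSup₂ (f := fun j (_ : j ≠ i) => E k j) j hj) (h k j b hb)
  exact hle ha'

/-- The sum `⨁_γ C_γ` of a family of additive subgroups of a ring which multiplies like a
`Γ`-grading, as a subring. -/
def sumSubring {A : Type w} [NonUnitalRing A] (C : GMor Γ → AddSubgroup A)
    (mul_mem : ∀ {x y z : Γ} (γ : y ⟶ z) (δ : x ⟶ y) {a b : A},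
      a ∈ C ⟨γ⟩ → b ∈ C ⟨δ⟩ → a * b ∈ C ⟨δ ≫ γ⟩)
    (mul_eq_zero : ∀ (γ δ : GMor Γ) {a b : A}, γ.d ≠ δ.r → a ∈ C γ → b ∈ C δ → a * b = 0) :
    NonUnitalSubring A :=
  { (⨆ γ, C γ : AddSubgroup A) with
    mul_mem' := by
      intro a b ha hb
      change a ∈ (⨆ γ, C γ : AddSubgroup A) at ha
      change b ∈ (⨆ γ, C γ : AddSubgroup A) at hb
      change a * b ∈ (⨆ γ, C γ : AddSubgroup A)
      refine AddSubgroup.iSup_induction C (C := fun a => a * b ∈ (⨆ γ, C γ : AddSubgroup A))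
        ha (fun γ a ha => ?_) (by simp) (fun a₁ a₂ h₁ h₂ => by rw [add_mul]; exact add_mem h₁ h₂)
      refine AddSubgroup.iSup_induction C (C := fun b => a * b ∈ (⨆ γ, C γ : AddSubgroup A))
        hb (fun δ b hb => ?_) (by simp) (fun b₁ b₂ h₁ h₂ => by rw [mul_add]; exact add_mem h₁ h₂)
      by_cases hγδ : γ.d = δ.r
      · obtain ⟨γ⟩ := γ
        obtain ⟨δ⟩ := δ
        dsimp only at hγδ
        subst hγδ
        exact AddSubgroup.mem_iSup_of_mem _ (mul_mem γ δ ha hb)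
      · rw [mul_eq_zero γ δ hγδ ha hb]
        exact zero_mem _ }

/-- An independent family of additive subgroups of a ring which multiplies like a `Γ`-grading
and has local identity elements makes its sum `⨁_γ C_γ` a `Γ`-graded ring. -/
def GrRing.ofFamily (A : Type w) [NonUnitalRing A] (C : GMor Γ → AddSubgroup A)
    (indep : iSupIndep C)
    (mul_mem : ∀ {x y z : Γ} (γ : y ⟶ z) (δ : x ⟶ y) {a b : A},
      a ∈ C ⟨γ⟩ → b ∈ C ⟨δ⟩ → a * b ∈ C ⟨δ ≫ γ⟩)
    (mul_eq_zero : ∀ (γ δ : GMor Γ) {a b : A}, γ.d ≠ δ.r → a ∈ C γ → b ∈ C δ → a * b = 0)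
    (one : Γ → A) (one_mem : ∀ e : Γ, one e ∈ C ⟨𝟙 e⟩)
    (one_mul : ∀ (γ : GMor Γ) {a : A}, a ∈ C γ → one γ.r * a = a)
    (mul_one : ∀ (γ : GMor Γ) {a : A}, a ∈ C γ → a * one γ.d = a) : GrRing.{u, v, w} Γ where
  carrier := sumSubring C mul_mem mul_eq_zero
  comp γ := (C γ).comap
    (NonUnitalSubringClass.subtype (sumSubring C mul_mem mul_eq_zero)).toAddMonoidHom
  indep := iSupIndep_of_maps (κ := Unit) (B := fun _ => A) _
    (fun _ => (NonUnitalSubringClass.subtype (sumSubring C mul_mem mul_eq_zero)).toAddMonoidHom)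
    (fun _ => C) (fun _ => indep) (fun a h => Subtype.ext (h ())) (fun _ _ _ h => h)
  iSup_comp := by
    rw [eq_top_iff]
    rintro ⟨a, ha⟩ -
    change a ∈ (⨆ γ, C γ : AddSubgroup A) at ha
    have key : (⨆ γ, C γ : AddSubgroup A) ≤
        (⨆ γ, (C γ).comap (NonUnitalSubringClass.subtype
          (sumSubring C mul_mem mul_eq_zero)).toAddMonoidHom).map
          (NonUnitalSubringClass.subtype (sumSubring C mul_mem mul_eq_zero)).toAddMonoidHom := by
      refine iSup_le fun γ b hb => ?_
      have hb' : b ∈ (⨆ γ, C γ : AddSubgroup A) := AddSubgroup.mem_iSup_of_mem γ hb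
      exact ⟨⟨b, hb'⟩, AddSubgroup.mem_iSup_of_mem γ hb, rfl⟩
    obtain ⟨c, hc, hca⟩ := key ha
    have : c = ⟨a, ha⟩ := Subtype.ext hca
    exact this ▸ hc
  mul_mem γ δ _ _ ha hb := mul_mem γ δ ha hb
  mul_eq_zero γ δ _ _ h ha hb := Subtype.ext (mul_eq_zero γ δ h ha hb)
  one e := ⟨one e, (AddSubgroup.mem_iSup_of_mem _ (one_mem e) :
    one e ∈ (⨆ γ, C γ : AddSubgroup A))⟩
  one_mem e := one_mem e
  one_mul γ _ ha := Subtype.ext (one_mul γ ha)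
  mul_one γ _ ha := Subtype.ext (mul_one γ ha)

/-! ### Graded direct products -/

section Product

variable {J : Type w} (R : J → GrRing.{u, v, w} Γ)

/-- The homogeneous component `∏_j (R_j)_γ` of the graded direct product. -/
def prodComp (γ : GMor Γ) : AddSubgroup (∀ j, (R j).carrier) :=
  AddSubgroup.pi Set.univ fun j => (R j).comp γ

/-- The graded direct product `∏^gr_j R_j = ⨁_γ ∏_j (R_j)_γ`. -/
def grProd : GrRing.{u, v, w} Γ :=
  GrRing.ofFamily (∀ j, (R j).carrier) (prodComp R)
    (iSupIndep_of_maps _ (fun j => Pi.evalAddMonoidHom _ j) (fun j => (R j).comp)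
      (fun j => (R j).indep) (fun _ h => funext h) (fun j _ _ h => h j trivial))
    (fun γ δ _ _ ha hb j _ => (R j).mul_mem γ δ (ha j trivial) (hb j trivial))
    (fun γ δ _ _ h ha hb => funext fun j =>
      (R j).mul_eq_zero γ δ h (ha j trivial) (hb j trivial))
    (fun e j => (R j).one e) (fun e j _ => (R j).one_mem e)
    (fun γ _ ha => funext fun j => (R j).one_mul γ (ha j trivial))
    (fun γ _ ha => funext fun j => (R j).mul_one γ (ha j trivial))

/-- The family is summable if `∏^gr_j R_j = ⨁_j R_j`, as subsets of `∏_j R_j`. -/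
def IsGrSummable : Prop :=
  ∀ x : ∀ j, (R j).carrier, x ∈ (⨆ γ, prodComp R γ) ↔ {j | x j ≠ 0}.Finite

end Product

/-! ### Matrices with finitely many nonzero entries -/

section FinMat

/-- The additive group of `I × I` matrices with only finitely many nonzero entries. -/
def finMatAddSubgroup (I : Type*) (A : Type*) [AddGroup A] : AddSubgroup (I → I → A) where
  carrier := {M | {p : I × I | M p.1 p.2 ≠ 0}.Finite}
  zero_mem' := by simp
  add_mem' := by
    intro M N hM hN
    refine (hM.union hN).subset fun p hp => ?_
    by_contra h
    simp only [Set.mem_union, Set.mem_ofPred_eq, not_or, not_not] at h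
    exact hp (by simp [h.1, h.2])
  neg_mem' := by
    intro M hM
    simpa using hM

/-- `M_I(A)`: the `I × I` matrices with only finitely many nonzero entries in `A`. -/
def FinMat (I : Type*) (A : Type*) [NonUnitalRing A] : Type _ := finMatAddSubgroup I A

variable {I : Type*} {A : Type*} [NonUnitalRing A]

instance : AddCommGroup (FinMat I A) := inferInstanceAs (AddCommGroup (finMatAddSubgroup I A))

/-- The `(i, j)`-entry of a matrix, as an additive homomorphism. -/
def FinMat.entry (i j : I) : FinMat I A →+ A where
  toFun M := M.1 i j
  map_zero' := rfl
  map_add' _ _ := rfl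

theorem FinMat.ext {M N : FinMat I A} (h : ∀ i j, FinMat.entry i j M = FinMat.entry i j N) :
    M = N :=
  Subtype.ext (funext fun i => funext fun j => h i j)

theorem FinMat.finite (M : FinMat I A) : {p : I × I | FinMat.entry p.1 p.2 M ≠ 0}.Finite := M.2

/-- The usual product of matrices, `(MN)_{ij} = ∑_k M_{ik} N_{kj}`. -/
noncomputable instance : Mul (FinMat I A) where
  mul M N := ⟨fun i j => ∑ᶠ k, FinMat.entry i k M * FinMat.entry k j N, by
    refine ((M.finite.image Prod.fst).prod (N.finite.image Prod.snd)).subset ?_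
    rintro ⟨i, j⟩ hp
    obtain ⟨k, hk⟩ : ∃ k, FinMat.entry i k M * FinMat.entry k j N ≠ 0 := by
      by_contra! h
      exact hp (by simp [h])
    exact ⟨⟨(i, k), left_ne_zero_of_mul hk, rfl⟩, ⟨(k, j), right_ne_zero_of_mul hk, rfl⟩⟩⟩

theorem FinMat.entry_mul (M N : FinMat I A) (i j : I) :
    FinMat.entry i j (M * N) = ∑ᶠ k, FinMat.entry i k M * FinMat.entry k j N := rfl

theorem FinMat.exists_finset (M : FinMat I A) :
    ∃ s : Finset I, ∀ i k, FinMat.entry i k M ≠ 0 → i ∈ s ∧ k ∈ s := by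
  classical
  refine ⟨(M.finite.image Prod.fst).toFinset ∪ (M.finite.image Prod.snd).toFinset,
    fun i k h => ?_⟩
  simp only [Finset.mem_union, Set.Finite.mem_toFinset]
  exact ⟨Or.inl ⟨(i, k), h, rfl⟩, Or.inr ⟨(i, k), h, rfl⟩⟩

theorem FinMat.entry_mul_left (M N : FinMat I A) (s : Finset I)
    (hs : ∀ i k, FinMat.entry i k M ≠ 0 → k ∈ s) (i j : I) :
    FinMat.entry i j (M * N) = ∑ k ∈ s, FinMat.entry i k M * FinMat.entry k j N := by
  rw [FinMat.entry_mul]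
  exact finsum_eq_sum_of_support_subset _ fun k hk => hs i k (left_ne_zero_of_mul hk)

noncomputable instance : NonUnitalRing (FinMat I A) where
  left_distrib M N P := by
    obtain ⟨s, hs⟩ := M.exists_finset
    refine FinMat.ext fun i j => ?_
    rw [map_add]
    simp only [FinMat.entry_mul_left M _ s fun i k h => (hs i k h).2, map_add, mul_add,
      Finset.sum_add_distrib]
  right_distrib M N P := by
    classical
    obtain ⟨s, hs⟩ := M.exists_finset
    obtain ⟨t, ht⟩ := N.exists_finset
    have hst : ∀ i k, FinMat.entry i k (M + N) ≠ 0 → k ∈ s ∪ t := by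
      intro i k h
      by_contra hk
      rw [Finset.mem_union, not_or] at hk
      refine h ?_
      rw [map_add, not_not.1 (mt (hs i k) fun h => hk.1 h.2),
        not_not.1 (mt (ht i k) fun h => hk.2 h.2), add_zero]
    refine FinMat.ext fun i j => ?_
    rw [map_add, FinMat.entry_mul_left _ _ (s ∪ t) hst,
      FinMat.entry_mul_left M _ (s ∪ t) fun i k h => Finset.mem_union_left _ (hs i k h).2,
      FinMat.entry_mul_left N _ (s ∪ t) fun i k h => Finset.mem_union_right _ (ht i k h).2]
    simp only [map_add, add_mul, Finset.sum_add_distrib]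
  zero_mul M := FinMat.ext fun i j => by simp [FinMat.entry_mul]
  mul_zero M := FinMat.ext fun i j => by simp [FinMat.entry_mul]
  mul_assoc M N P := by
    obtain ⟨s, hs⟩ := M.exists_finset
    obtain ⟨t, ht⟩ := N.exists_finset
    have hMN : ∀ i l, FinMat.entry i l (M * N) ≠ 0 → l ∈ t := by
      intro i l h
      by_contra hl
      refine h ?_
      rw [FinMat.entry_mul_left M N s fun i k h => (hs i k h).2]
      refine Finset.sum_eq_zero fun k _ => ?_
      rw [not_not.1 (mt (ht k l) fun h => hl h.2), mul_zero]
    refine FinMat.ext fun i j => ?_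
    rw [FinMat.entry_mul_left _ _ t hMN,
      FinMat.entry_mul_left M _ s fun i k h => (hs i k h).2]
    simp only [FinMat.entry_mul_left M N s fun i k h => (hs i k h).2,
      FinMat.entry_mul_left N P t fun i k h => (ht i k h).2, Finset.sum_mul, Finset.mul_sum,
      mul_assoc]
    exact Finset.sum_comm

end FinMat

/-! ### Graded matrix rings -/

section Matrix

variable (D : GrRing.{u, v, w} Γ)

/-- `Σ` is `d`-unique: for each object `e` there is at most one `σ ∈ Σ` with `d(σ) = e`. -/
def DUnique (S : Set (GMor Γ)) : Prop := ∀ σ ∈ S, ∀ τ ∈ S, σ.d = τ.d → σ = τ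

/-- `Σ` is `r`-unique for `D`: all `r(σ)` with `σ ∈ Σ` lie in `Γ₀'(D)`, and for each object `e`
there is at most one `σ ∈ Σ` with `r(σ) = e`. -/
def RUnique (S : Set (GMor Γ)) : Prop :=
  (∀ σ ∈ S, σ.r ∈ D.objSupp) ∧ ∀ σ ∈ S, ∀ τ ∈ S, σ.r = τ.r → σ = τ

/-- A sequence `(Σ_i)` is `d`-finite: for each object `e`, there are only finitely many `i` such
that `d(σ) = e` for some `σ ∈ Σ_i`. -/
def DFinite {I : Type*} (S : I → Set (GMor Γ)) : Prop :=
  ∀ e : Γ, {i | ∃ σ ∈ S i, σ.d = e}.Finite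

/-- A sequence of nonempty subsets of `Γ`, indexed by a nonempty set, is matricial for `D`. -/
structure IsMatricial {I : Type*} (S : I → Set (GMor Γ)) : Prop where
  nonempty_index : Nonempty I
  nonempty : ∀ i, (S i).Nonempty
  dUnique : ∀ i, DUnique (S i)
  rUnique : ∀ i, RUnique D (S i)
  dFinite : DFinite S

/-- `D_{S γ T⁻¹}`: for `d`-unique `S` and `T`, this is `D_{σγτ⁻¹}` if there are `σ ∈ S` and
`τ ∈ T` with `d(σ) = r(γ)` and `d(τ) = d(γ)`, and `0` otherwise. -/
def sandwich (S T : Set (GMor Γ)) (γ : GMor Γ) : AddSubgroup D.carrier :=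
  ⨆ (x : Γ) (y : Γ) (σ : γ.r ⟶ x) (τ : γ.d ⟶ y) (_ : (⟨σ⟩ : GMor Γ) ∈ S)
    (_ : (⟨τ⟩ : GMor Γ) ∈ T), D.comp ⟨Groupoid.inv τ ≫ γ.hom ≫ σ⟩

variable {D}

theorem comp_le_sandwich {S T : Set (GMor Γ)} {γ : GMor Γ} {x y : Γ} (σ : γ.r ⟶ x)
    (τ : γ.d ⟶ y) (hσ : (⟨σ⟩ : GMor Γ) ∈ S) (hτ : (⟨τ⟩ : GMor Γ) ∈ T) :
    D.comp ⟨Groupoid.inv τ ≫ γ.hom ≫ σ⟩ ≤ sandwich D S T γ := by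
  unfold sandwich
  exact le_iSup_of_le x <| le_iSup_of_le y <| le_iSup_of_le σ <| le_iSup_of_le τ <|
    le_iSup_of_le hσ <| le_iSup_of_le hτ le_rfl

theorem sandwich_eq_comp {S T : Set (GMor Γ)} (hS : DUnique S) (hT : DUnique T) {γ : GMor Γ}
    {x y : Γ} (σ : γ.r ⟶ x) (τ : γ.d ⟶ y) (hσ : (⟨σ⟩ : GMor Γ) ∈ S)
    (hτ : (⟨τ⟩ : GMor Γ) ∈ T) :
    sandwich D S T γ = D.comp ⟨Groupoid.inv τ ≫ γ.hom ≫ σ⟩ := by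
  refine le_antisymm ?_ (comp_le_sandwich σ τ hσ hτ)
  unfold sandwich
  refine iSup_le fun x' => iSup_le fun y' => iSup_le fun σ' => iSup_le fun τ' =>
    iSup_le fun hσ' => iSup_le fun hτ' => ?_
  have h₁ := hS _ hσ' _ hσ rfl
  have h₂ := hT _ hτ' _ hτ rfl
  cases h₁
  cases h₂
  exact le_rfl

theorem exists_of_mem_sandwich {S T : Set (GMor Γ)} (hS : DUnique S) (hT : DUnique T)
    {γ : GMor Γ} {a : D.carrier} (ha : a ∈ sandwich D S T γ) (ha0 : a ≠ 0) :
    ∃ (x y : Γ) (σ : γ.r ⟶ x) (τ : γ.d ⟶ y), (⟨σ⟩ : GMor Γ) ∈ S ∧ (⟨τ⟩ : GMor Γ) ∈ T ∧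
      a ∈ D.comp ⟨Groupoid.inv τ ≫ γ.hom ≫ σ⟩ := by
  by_cases h : ∃ (x y : Γ) (σ : γ.r ⟶ x) (τ : γ.d ⟶ y), (⟨σ⟩ : GMor Γ) ∈ S ∧
      (⟨τ⟩ : GMor Γ) ∈ T
  · obtain ⟨x, y, σ, τ, hσ, hτ⟩ := h
    exact ⟨x, y, σ, τ, hσ, hτ, sandwich_eq_comp hS hT σ τ hσ hτ ▸ ha⟩
  · exfalso
    have : sandwich D S T γ ≤ ⊥ := by
      unfold sandwich
      refine iSup_le fun x' => iSup_le fun y' => iSup_le fun σ' => iSup_le fun τ' =>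
        iSup_le fun hσ' => iSup_le fun hτ' => (h ⟨x', y', σ', τ', hσ', hτ'⟩).elim
    exact ha0 (this ha)

theorem iSupIndep_sandwich {S T : Set (GMor Γ)} (hS : DUnique S) (hT : DUnique T)
    (hS' : RUnique D S) (hT' : RUnique D T) : iSupIndep (sandwich D S T) := by
  intro γ
  rw [AddSubgroup.disjoint_def]
  intro a ha ha'
  by_contra ha0
  obtain ⟨x, y, σ, τ, hσ, hτ, ha⟩ := exists_of_mem_sandwich hS hT ha ha0
  refine ha0 ((AddSubgroup.disjoint_def.1 (D.indep ⟨Groupoid.inv τ ≫ γ.hom ≫ σ⟩)) ha ?_)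
  refine (iSup₂_le fun δ hδ => ?_ : (⨆ (δ) (_ : δ ≠ γ), sandwich D S T δ) ≤ _) ha'
  conv_lhs => unfold sandwich
  refine iSup_le fun x' => iSup_le fun y' => iSup_le fun σ' => iSup_le fun τ' =>
    iSup_le fun hσ' => iSup_le fun hτ' => ?_
  refine le_iSup₂_of_le (⟨Groupoid.inv τ' ≫ δ.hom ≫ σ'⟩ : GMor Γ) ?_ le_rfl
  intro heq
  apply hδ
  have hx : x' = x := congrArg GMor.r heq
  have hy : y' = y := congrArg GMor.d heq
  subst hx hy
  have h₁ := hS'.2 _ hσ' _ hσ rfl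
  have h₂ := hT'.2 _ hτ' _ hτ rfl
  obtain ⟨γ⟩ := γ
  obtain ⟨δ⟩ := δ
  cases h₁
  cases h₂
  simp only [GMor.mk.injEq, heq_eq_eq, true_and] at heq
  have : δ = γ := by
    have := congrArg (fun f => τ ≫ f ≫ Groupoid.inv σ) heq
    simpa using this
  rw [this]

variable (D)

/-- `M_I(D)(Σ)_γ`: the matrices `(a_{ij})` in `M_I(D)` with `a_{ij} ∈ D_{Σ_i γ Σ_j⁻¹}`. -/
def matComp {I : Type w} (S : I → Set (GMor Γ)) (γ : GMor Γ) :
    AddSubgroup (FinMat I D.carrier) :=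
  ⨅ (i : I) (j : I), (sandwich D (S i) (S j) γ).comap (FinMat.entry i j)

variable {D}

theorem mem_matComp {I : Type w} {S : I → Set (GMor Γ)} {γ : GMor Γ}
    {M : FinMat I D.carrier} :
    M ∈ matComp D S γ ↔ ∀ i j, FinMat.entry i j M ∈ sandwich D (S i) (S j) γ := by
  simp [matComp, AddSubgroup.mem_iInf]

variable (D)

open Classical in
/-- The diagonal entries of the identity matrices: `1_{r(σ)}` if there is a `σ ∈ S` with
`d(σ) = e`, and `0` otherwise. -/
noncomputable def diagEntry (S : Set (GMor Γ)) (e : Γ) : D.carrier :=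
  if h : ∃ σ ∈ S, σ.d = e then D.one h.choose.r else 0

variable {D}

theorem diagEntry_of_mem {S : Set (GMor Γ)} (hS : DUnique S) {e x : Γ} (σ : e ⟶ x)
    (hσ : (⟨σ⟩ : GMor Γ) ∈ S) : diagEntry D S e = D.one x := by
  have h : ∃ σ ∈ S, σ.d = e := ⟨_, hσ, rfl⟩
  rw [diagEntry, dif_pos h]
  exact congrArg (fun τ : GMor Γ => D.one τ.r)
    (hS _ h.choose_spec.1 _ hσ h.choose_spec.2)

theorem diagEntry_mem {S : Set (GMor Γ)} (hS : DUnique S) (e : Γ) :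
    diagEntry D S e ∈ sandwich D S S ⟨𝟙 e⟩ := by
  by_cases h : ∃ σ ∈ S, σ.d = e
  · obtain ⟨⟨σ⟩, hσ, he⟩ := h
    dsimp only at he
    subst he
    rw [diagEntry_of_mem hS σ hσ,
      sandwich_eq_comp (γ := ⟨𝟙 _⟩) hS hS σ σ hσ hσ]
    have := D.one_mem (Γ := Γ)
    simpa using this _
  · rw [diagEntry, dif_neg h]
    exact zero_mem _

variable (D)

open Classical in
/-- The identity matrix `𝕀_e`, the sum of all `E_{ii}^{r(σ)}` with `σ ∈ Σ_i`, `d(σ) = e`. -/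
noncomputable def idMat {I : Type w} (S : I → Set (GMor Γ)) (hS : DFinite S) (e : Γ) :
    FinMat I D.carrier :=
  ⟨fun i j => if i = j then diagEntry D (S i) e else 0, by
    refine ((hS e).image fun i => (i, i)).subset ?_
    rintro ⟨i, j⟩ h
    by_cases hij : i = j
    · subst hij
      refine ⟨i, ?_, rfl⟩
      by_contra h'
      exact h (by simp only [if_true]; exact dif_neg h')
    · exact (h (if_neg hij)).elim⟩

variable {D}

theorem idMat_mul_entry {I : Type w} {S : I → Set (GMor Γ)} (hS : DFinite S) (e : Γ)
    (M : FinMat I D.carrier) (i j : I) :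
    FinMat.entry i j (idMat D S hS e * M) = diagEntry D (S i) e * FinMat.entry i j M := by
  rw [FinMat.entry_mul, finsum_eq_single _ i]
  · exact congrArg (· * FinMat.entry i j M) (if_pos rfl)
  · intro k hk
    exact (congrArg (· * FinMat.entry k j M) (if_neg (Ne.symm hk))).trans (zero_mul _)

theorem mul_idMat_entry {I : Type w} {S : I → Set (GMor Γ)} (hS : DFinite S) (e : Γ)
    (M : FinMat I D.carrier) (i j : I) :
    FinMat.entry i j (M * idMat D S hS e) = FinMat.entry i j M * diagEntry D (S j) e := by
  rw [FinMat.entry_mul, finsum_eq_single _ j]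
  · exact congrArg (FinMat.entry i j M * ·) (if_pos rfl)
  · intro k hk
    exact (congrArg (FinMat.entry i k M * ·) (if_neg hk)).trans (mul_zero _)

theorem sandwich_mul_mem {S T U : Set (GMor Γ)} (hS : DUnique S) (hT : DUnique T)
    (hU : DUnique U) {x y z : Γ} (γ : y ⟶ z) (δ : x ⟶ y) {a b : D.carrier}
    (ha : a ∈ sandwich D S T ⟨γ⟩) (hb : b ∈ sandwich D T U ⟨δ⟩) :
    a * b ∈ sandwich D S U ⟨δ ≫ γ⟩ := by
  by_cases ha0 : a = 0
  · rw [ha0, zero_mul]; exact zero_mem _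
  by_cases hb0 : b = 0
  · rw [hb0, mul_zero]; exact zero_mem _
  obtain ⟨x₁, y₁, σ, τ, hσ, hτ, ha⟩ := exists_of_mem_sandwich hS hT ha ha0
  obtain ⟨x₂, y₂, σ', τ', hσ', hτ', hb⟩ := exists_of_mem_sandwich hT hU hb hb0
  dsimp only at σ τ σ' τ' ha hb
  cases hT _ hσ' _ hτ rfl
  have := D.mul_mem _ _ ha hb
  refine comp_le_sandwich (γ := ⟨δ ≫ γ⟩) σ τ' hσ hτ' ?_
  simpa using this

theorem sandwich_mul_eq_zero {S T U : Set (GMor Γ)} (hS : DUnique S) (hT : DUnique T)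
    (hU : DUnique U) (hT' : RUnique D T) (γ δ : GMor Γ) (h : γ.d ≠ δ.r) {a b : D.carrier}
    (ha : a ∈ sandwich D S T γ) (hb : b ∈ sandwich D T U δ) : a * b = 0 := by
  by_cases ha0 : a = 0
  · rw [ha0, zero_mul]
  by_cases hb0 : b = 0
  · rw [hb0, mul_zero]
  obtain ⟨x₁, y₁, σ, τ, hσ, hτ, ha⟩ := exists_of_mem_sandwich hS hT ha ha0
  obtain ⟨x₂, y₂, σ', τ', hσ', hτ', hb⟩ := exists_of_mem_sandwich hT hU hb hb0
  refine D.mul_eq_zero _ _ (fun heq => h ?_) ha hb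
  exact congrArg GMor.d (hT'.2 _ hτ _ hσ' heq)

theorem entry_mul_mem {I : Type*} {A : Type*} [NonUnitalRing A] (H : AddSubgroup A)
    (M N : FinMat I A) (i j : I)
    (h : ∀ k, FinMat.entry i k M * FinMat.entry k j N ∈ H) :
    FinMat.entry i j (M * N) ∈ H := by
  obtain ⟨s, hs⟩ := M.exists_finset
  rw [FinMat.entry_mul_left M N s fun i k h => (hs i k h).2]
  exact sum_mem fun k _ => h k

/-- The graded matrix ring `M_I(D)(Σ) = ⨁_γ M_I(D)(Σ)_γ` of a matricial sequence. -/
noncomputable def grMatrix (D : GrRing.{u, v, w} Γ) {I : Type w} (S : I → Set (GMor Γ))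
    (hS : IsMatricial D S) : GrRing.{u, v, w} Γ :=
  GrRing.ofFamily (FinMat I D.carrier) (matComp D S)
    (iSupIndep_of_maps (κ := I × I) (B := fun _ => D.carrier) _
      (fun p => FinMat.entry p.1 p.2) (fun p => sandwich D (S p.1) (S p.2))
      (fun p => iSupIndep_sandwich (hS.dUnique _) (hS.dUnique _) (hS.rUnique _) (hS.rUnique _))
      (fun _ h => FinMat.ext fun i j => (h (i, j)).trans (map_zero _).symm)
      (fun p _ _ h => mem_matComp.1 h p.1 p.2))
    (fun γ δ M N hM hN => mem_matComp.2 fun i j => entry_mul_mem _ M N i j fun k =>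
      sandwich_mul_mem (hS.dUnique i) (hS.dUnique k) (hS.dUnique j) γ δ
        (mem_matComp.1 hM i k) (mem_matComp.1 hN k j))
    (fun γ δ M N h hM hN => FinMat.ext fun i j => by
      have := entry_mul_mem ⊥ M N i j fun k => (AddSubgroup.mem_bot).2 <|
        sandwich_mul_eq_zero (hS.dUnique i) (hS.dUnique k) (hS.dUnique j)
          (hS.rUnique k) γ δ h (mem_matComp.1 hM i k) (mem_matComp.1 hN k j)
      simpa using this)
    (idMat D S hS.dFinite)
    (fun e => mem_matComp.2 fun i j => by
      by_cases hij : i = j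
      · subst hij
        have : FinMat.entry i i (idMat D S hS.dFinite e) = diagEntry D (S i) e := if_pos rfl
        rw [this]
        exact diagEntry_mem (hS.dUnique i) e
      · have : FinMat.entry i j (idMat D S hS.dFinite e) = 0 := if_neg hij
        rw [this]
        exact zero_mem _)
    (fun γ M hM => FinMat.ext fun i j => by
      rw [idMat_mul_entry]
      by_cases h0 : FinMat.entry i j M = 0
      · rw [h0, mul_zero]
      obtain ⟨x, y, σ, τ, hσ, hτ, h⟩ := exists_of_mem_sandwich (hS.dUnique i) (hS.dUnique j)
        (mem_matComp.1 hM i j) h0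
      rw [diagEntry_of_mem (hS.dUnique i) σ hσ]
      exact D.one_mul _ h)
    (fun γ M hM => FinMat.ext fun i j => by
      rw [mul_idMat_entry]
      by_cases h0 : FinMat.entry i j M = 0
      · rw [h0, zero_mul]
      obtain ⟨x, y, σ, τ, hσ, hτ, h⟩ := exists_of_mem_sandwich (hS.dUnique i) (hS.dUnique j)
        (mem_matComp.1 hM i j) h0
      rw [diagEntry_of_mem (hS.dUnique j) τ hτ]
      exact D.mul_one _ h)

/-- If `D` is a gr-division ring supported in `eΓe`, then every `d`-finite sequence `(σ_i)` of
elements of `eΓ` is matricial for `D` (as the sequence of the sets `{σ_i}`). -/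
theorem isMatricial_singleton {D : GrRing.{u, v, w} Γ} (hD : D.IsGrDivision) {e : Γ}
    (hsupp : D.supp ⊆ {γ | γ.r = e ∧ γ.d = e}) {I : Type*} (hI : Nonempty I)
    {σ : I → GMor Γ} (hσ : ∀ i, (σ i).r = e) (hfin : DFinite fun i => ({σ i} : Set (GMor Γ))) :
    IsMatricial D fun i => ({σ i} : Set (GMor Γ)) where
  nonempty_index := hI
  nonempty i := ⟨σ i, rfl⟩
  dUnique i := by
    rintro _ rfl _ rfl _
    rfl
  rUnique i := by
    refine ⟨?_, by rintro _ rfl _ rfl _; rfl⟩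
    rintro _ rfl
    rw [hσ i]
    intro h1
    obtain ⟨a, ha⟩ := @exists_ne _ hD.1 (0 : D.carrier)
    have htop : (⨆ γ, D.comp γ) ≤ ⊥ := by
      refine iSup_le fun γ b hb => ?_
      by_contra hb0
      have hγ : γ ∈ D.supp := by
        intro hbot
        rw [hbot] at hb
        exact hb0 hb
      refine hb0 ?_
      rw [AddSubgroup.mem_bot, ← D.one_mul γ hb, (hsupp hγ).1, h1, zero_mul]
    rw [D.iSup_comp] at htop
    exact ha (htop (AddSubgroup.mem_top a))
  dFinite := hfin

end Matrix

end GroupoidGraded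

open GroupoidGraded

/-! The argument is Wedderburn–Artin theory carried out on homogeneous elements rather than on
modules. Call a homogeneous `s` right minimal (`RightMin`) if every nonzero product `s * a` with `a`
homogeneous can be multiplied back to `s` by an element of inverse degree. For `s ≠ 0` this says
that `sR` is gr-simple, so right gr-semisimplicity becomes `IsRightMinSpanned`: right minimal
elements generate `R` additively. Since minimality survives multiplication on the right by
homogeneous elements, only the local identities `1_e` need to be tested
(`isRightMinSpanned_of_one_mem`).

In a spanned ring, an expression of `1_e` as a shortest sum of minimal elements of `R_e` consists of
orthogonal idempotents (`exists_isIdemSystem`). Everything else rests on these idempotents. A right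
minimal idempotent is also left minimal (`leftMin_of_idem`), which gives left-right symmetry via the
opposite ring, graded by inverse degrees. A finite exchange argument on `1_eR = ⨁ uR` gives the
descending chain condition (`isRightArtinian`).

For the structure theorem, collect the idempotents of all objects and call two of them connected if
a nonzero homogeneous element lies between them. By Schur's lemma (`exists_inverse_of_rightMin`)
such an element is invertible, so connectedness is an equivalence relation and each corner `uRu` is
a gr-division ring supported in one isotropy group. Fix a representative `u` of each class and
matrix units `p_k`, `q_k` linking it to the other members. Then `a ↦ (p_k a q_l)` maps `R` to a
graded matrix ring over `uRu`, and all classes together give an isomorphism onto a summable graded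
product (`exists_grIso`).

Conversely, a graded matrix ring over a gr-division ring is spanned by its diagonal idempotents
(`grMatrix_isRightMinSpanned`). A gr-simple right artinian ring is spanned because its minimal
elements generate a nonzero graded ideal (`IsGrSimple.isRightMinSpanned`). Summable products and
gr-isomorphisms preserve spannedness, since summability makes each `1_e` a finite sum over the
factors. -/

namespace GroupoidGraded

variable {Γ : Type u} [Groupoid.{v} Γ]

/-! ### Inverses of morphisms -/

/-- The inverse of a morphism. -/
def GMor.inv (γ : GMor Γ) : GMor Γ := ⟨Groupoid.inv γ.hom⟩

@[simp] theorem GMor.inv_r (γ : GMor Γ) : γ.inv.r = γ.d := rfl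

@[simp] theorem GMor.inv_inv (γ : GMor Γ) : γ.inv.inv = γ := by
  simp [GMor.inv]

theorem GMor.inv_injective : Function.Injective (GMor.inv : GMor Γ → GMor Γ) :=
  fun γ δ h => by rw [← γ.inv_inv, h, δ.inv_inv]

namespace GrRing

variable (R : GrRing.{u, v, w} Γ)

/-! ### Homogeneous components -/

@[elab_as_elim]
theorem homogeneous_induction {p : R.carrier → Prop} (a : R.carrier)
    (mem : ∀ γ, ∀ x ∈ R.comp γ, p x) (zero : p 0) (add : ∀ x y, p x → p y → p (x + y)) :
    p a :=
  AddSubgroup.iSup_induction R.comp (C := p) (by rw [R.iSup_comp]; trivial) mem zero add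

-- Connects the grading with Mathlib's `DirectSum`, whose decomposition supplies the homogeneous
-- components `proj`.
open Classical in
theorem isInternal : DirectSum.IsInternal R.comp := by
  refine ⟨R.indep.dfinsuppSumAddHom_injective, fun a => ?_⟩
  induction a using R.homogeneous_induction with
  | mem γ x hx => exact ⟨DirectSum.of (fun γ => R.comp γ) γ ⟨x, hx⟩, by simp⟩
  | zero => exact ⟨0, map_zero _⟩
  | add x y hx hy =>
    obtain ⟨x', rfl⟩ := hx
    obtain ⟨y', rfl⟩ := hy
    exact ⟨x' + y', map_add _ _ _⟩

open Classical in
/-- The homogeneous component of degree `γ`, as an additive map. -/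
noncomputable def proj (γ : GMor Γ) : R.carrier →+ R.carrier :=
  letI := R.isInternal.chooseDecomposition
  ((R.comp γ).subtype.comp (DFinsupp.evalAddMonoidHom γ)).comp
    (DirectSum.decomposeAddEquiv R.comp).toAddMonoidHom

theorem proj_mem (γ : GMor Γ) (a : R.carrier) : R.proj γ a ∈ R.comp γ := by
  simp [proj]

variable {R}

theorem proj_of_mem {γ : GMor Γ} {a : R.carrier} (ha : a ∈ R.comp γ) : R.proj γ a = a := by
  classical
  let := R.isInternal.chooseDecomposition
  exact DirectSum.decompose_of_mem_same R.comp ha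

theorem proj_of_mem_ne {γ δ : GMor Γ} {a : R.carrier} (ha : a ∈ R.comp γ) (h : γ ≠ δ) :
    R.proj δ a = 0 := by
  classical
  let := R.isInternal.chooseDecomposition
  exact DirectSum.decompose_of_mem_ne R.comp ha h

theorem eq_of_mem_of_mem {γ δ : GMor Γ} {a : R.carrier} (ha : a ∈ R.comp γ)
    (hb : a ∈ R.comp δ) (h0 : a ≠ 0) : γ = δ := by
  by_contra h
  exact h0 ((proj_of_mem hb).symm.trans (proj_of_mem_ne ha h))

theorem mem_of_forall_proj_mem {N : AddSubgroup R.carrier} {a : R.carrier}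
    (h : ∀ γ, R.proj γ a ∈ N) : a ∈ N := by
  classical
  let := R.isInternal.chooseDecomposition
  rw [← DirectSum.sum_support_decompose R.comp a]
  exact sum_mem fun γ _ => h γ

theorem eq_zero_of_forall_proj_eq_zero {a : R.carrier} (h : ∀ γ, R.proj γ a = 0) : a = 0 :=
  (AddSubgroup.mem_bot).1 (mem_of_forall_proj_mem fun γ => (AddSubgroup.mem_bot).2 (h γ))

/-! ### Products of homogeneous elements -/

theorem composable_of_mul_ne_zero {γ δ : GMor Γ} {a b : R.carrier} (ha : a ∈ R.comp γ)
    (hb : b ∈ R.comp δ) (h : a * b ≠ 0) : γ.d = δ.r := by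
  by_contra hne
  exact h (R.mul_eq_zero γ δ hne ha hb)

theorem exists_mul_mem {γ δ : GMor Γ} {a b : R.carrier} (ha : a ∈ R.comp γ)
    (hb : b ∈ R.comp δ) : ∃ ε, a * b ∈ R.comp ε := by
  by_cases h : γ.d = δ.r
  · obtain ⟨γ⟩ := γ
    obtain ⟨δ⟩ := δ
    dsimp only at h
    subst h
    exact ⟨_, R.mul_mem γ δ ha hb⟩
  · exact ⟨γ, by rw [R.mul_eq_zero γ δ h ha hb]; exact zero_mem _⟩

theorem mul_mem_of_mem_id_left {γ : GMor Γ} {e : Γ} {a b : R.carrier} (ha : a ∈ R.comp ⟨𝟙 e⟩)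
    (hb : b ∈ R.comp γ) : a * b ∈ R.comp γ := by
  by_cases h : e = γ.r
  · subst h
    simpa using R.mul_mem _ γ.hom ha hb
  · rw [R.mul_eq_zero ⟨𝟙 e⟩ γ h ha hb]; exact zero_mem _

theorem mul_mem_of_mem_id_right {γ : GMor Γ} {e : Γ} {a b : R.carrier} (ha : a ∈ R.comp γ)
    (hb : b ∈ R.comp ⟨𝟙 e⟩) : a * b ∈ R.comp γ := by
  by_cases h : γ.d = e
  · subst h
    simpa using R.mul_mem γ.hom _ ha hb
  · rw [R.mul_eq_zero γ ⟨𝟙 e⟩ h ha hb]; exact zero_mem _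

theorem mul_inv_mem {γ : GMor Γ} {a b : R.carrier} (ha : a ∈ R.comp γ)
    (hb : b ∈ R.comp γ.inv) : a * b ∈ R.comp ⟨𝟙 γ.r⟩ := by
  simpa using R.mul_mem γ.hom (Groupoid.inv γ.hom) ha hb

theorem one_mul_of_ne {γ : GMor Γ} {e : Γ} (h : γ.r ≠ e) {a : R.carrier} (ha : a ∈ R.comp γ) :
    R.one e * a = 0 :=
  R.mul_eq_zero ⟨𝟙 e⟩ γ (Ne.symm h) (R.one_mem e) ha

/-- Homogeneous components of a product with a homogeneous left factor. -/
theorem proj_mul_left {x y z : Γ} (γ : y ⟶ z) (ε : x ⟶ z) {h : R.carrier}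
    (hh : h ∈ R.comp ⟨γ⟩) (a : R.carrier) :
    R.proj ⟨ε⟩ (h * a) = h * R.proj ⟨ε ≫ Groupoid.inv γ⟩ a := by
  induction a using R.homogeneous_induction with
  | mem δ a ha =>
    by_cases hδ : δ = ⟨ε ≫ Groupoid.inv γ⟩
    · subst hδ
      have := R.mul_mem _ _ hh ha
      rw [proj_of_mem ha, proj_of_mem (by simpa using this)]
    · rw [proj_of_mem_ne ha hδ, mul_zero]
      by_cases hc : y = δ.r
      · obtain ⟨δ⟩ := δ
        dsimp only at hc
        subst hc
        refine proj_of_mem_ne (R.mul_mem γ δ hh ha) fun heq => hδ ?_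
        have hd := congrArg GMor.d heq
        dsimp only at hd
        subst hd
        simp only [GMor.mk.injEq, heq_eq_eq, true_and] at heq
        rw [← heq]
        simp
      · rw [R.mul_eq_zero ⟨γ⟩ δ hc hh ha, map_zero]
  | zero => simp
  | add a b ha hb => rw [mul_add, map_add, ha, hb, map_add, mul_add]

theorem proj_mul_left_of_ne {γ ε : GMor Γ} (hr : ε.r ≠ γ.r) {h : R.carrier}
    (hh : h ∈ R.comp γ) (a : R.carrier) : R.proj ε (h * a) = 0 := by
  induction a using R.homogeneous_induction with
  | mem δ a ha =>
    by_cases hc : γ.d = δ.r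
    · obtain ⟨γ⟩ := γ
      obtain ⟨δ⟩ := δ
      dsimp only at hc
      subst hc
      exact proj_of_mem_ne (R.mul_mem γ δ hh ha) fun heq => hr (congrArg GMor.r heq).symm
    · rw [R.mul_eq_zero γ δ hc hh ha, map_zero]
  | zero => simp
  | add a b ha hb => rw [mul_add, map_add, ha, hb, add_zero]

/-- Left multiplication by `h` shifts degrees by `γ`, so each component of `h * a` comes from one
component of `a`. If the codomains differ the component vanishes, and `b = 0` serves in an arbitrary
degree. -/
theorem exists_proj_mul_left {γ : GMor Γ} (ε : GMor Γ) {h : R.carrier} (hh : h ∈ R.comp γ)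
    (a : R.carrier) : ∃ δ, ∃ b ∈ R.comp δ, R.proj ε (h * a) = h * b := by
  by_cases hr : ε.r = γ.r
  · obtain ⟨γ⟩ := γ
    obtain ⟨ε⟩ := ε
    dsimp only at hr
    subst hr
    exact ⟨_, _, R.proj_mem _ _, proj_mul_left γ ε hh a⟩
  · exact ⟨γ, 0, zero_mem _, by rw [proj_mul_left_of_ne hr hh, mul_zero]⟩

/-! ### Graded subgroups -/

theorem IsGraded.proj_mem {N : AddSubgroup R.carrier} (hN : R.IsGraded N) (γ : GMor Γ)
    {a : R.carrier} (ha : a ∈ N) : R.proj γ a ∈ N := by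
  rw [hN] at ha
  refine AddSubgroup.iSup_induction (fun γ => N ⊓ R.comp γ) (C := fun a => R.proj γ a ∈ N)
    ha (fun δ a ha => ?_) (by simp) (fun a b ha hb => by rw [map_add]; exact add_mem ha hb)
  by_cases h : δ = γ
  · rw [← h, proj_of_mem ha.2]; exact ha.1
  · rw [proj_of_mem_ne ha.2 h]; exact zero_mem _

theorem isGraded_of_proj_mem {N : AddSubgroup R.carrier}
    (h : ∀ γ, ∀ a ∈ N, R.proj γ a ∈ N) : R.IsGraded N := by
  refine le_antisymm (fun a ha => ?_) (iSup_le fun γ => inf_le_left)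
  exact mem_of_forall_proj_mem fun γ =>
    AddSubgroup.mem_iSup_of_mem γ ⟨h γ a ha, R.proj_mem γ a⟩

theorem IsGraded.le_of_homogeneous {N M : AddSubgroup R.carrier} (hN : R.IsGraded N)
    (h : ∀ γ, ∀ a ∈ R.comp γ, a ∈ N → a ∈ M) : N ≤ M := fun _ ha =>
  mem_of_forall_proj_mem fun γ => h γ _ (R.proj_mem γ _) (hN.proj_mem γ ha)

theorem IsGraded.exists_ne_zero {N : AddSubgroup R.carrier} (hN : R.IsGraded N) (h : N ≠ ⊥) :
    ∃ γ, ∃ a ∈ R.comp γ, a ∈ N ∧ a ≠ 0 := by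
  by_contra! hc
  exact h (le_bot_iff.1 (hN.le_of_homogeneous fun γ a ha haN =>
    (AddSubgroup.mem_bot).2 (hc γ a ha haN)))

theorem isGrRightIdeal_mulLeft_range {γ : GMor Γ} {h : R.carrier} (hh : h ∈ R.comp γ) :
    R.IsGrRightIdeal (AddMonoidHom.mulLeft h).range where
  graded := isGraded_of_proj_mem fun ε a ha => by
    obtain ⟨b, rfl⟩ := ha
    obtain ⟨δ, c, hc, hb⟩ := exists_proj_mul_left ε hh b
    exact ⟨c, hb.symm⟩
  mul_mem_right := by
    rintro _ ⟨b, rfl⟩ a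
    exact ⟨b * a, (mul_assoc _ _ _).symm⟩

/-- There is no global identity; the local one at the domain of `γ` puts `h` into `hR`. -/
theorem mem_mulLeft_range_self {γ : GMor Γ} {h : R.carrier} (hh : h ∈ R.comp γ) :
    h ∈ (AddMonoidHom.mulLeft h).range :=
  ⟨R.one γ.d, R.mul_one γ hh⟩

/-! ### The opposite ring -/

variable (R)

/-- The opposite ring of `R`, graded by `(Rᵒᵖ)_γ = R_{γ⁻¹}`. -/
def op : GrRing.{u, v, w} Γ where
  carrier := R.carrierᵐᵒᵖ
  comp γ := (R.comp γ.inv).map (MulOpposite.opAddEquiv (α := R.carrier)).toAddMonoidHom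
  indep := (iSupIndep_map_orderIso_iff
    (MulOpposite.opAddEquiv (α := R.carrier)).mapAddSubgroup).2
    (R.indep.comp GMor.inv_injective)
  iSup_comp := by
    rw [← AddSubgroup.map_iSup, Function.Surjective.iSup_comp (g := R.comp)
      (fun γ : GMor Γ => ⟨γ.inv, γ.inv_inv⟩), R.iSup_comp]
    exact AddSubgroup.map_top_of_surjective _ (MulOpposite.opAddEquiv).surjective
  mul_mem := by
    rintro x y z γ δ _ _ ⟨a, ha, rfl⟩ ⟨b, hb, rfl⟩
    refine ⟨b * a, ?_, rfl⟩
    have := R.mul_mem _ _ hb ha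
    simpa [GMor.inv] using this
  mul_eq_zero := by
    rintro γ δ _ _ h ⟨a, ha, rfl⟩ ⟨b, hb, rfl⟩
    exact congrArg MulOpposite.op (R.mul_eq_zero δ.inv γ.inv (Ne.symm h) hb ha)
  one e := MulOpposite.op (R.one e)
  one_mem e := ⟨R.one e, by simpa [GMor.inv] using R.one_mem e, rfl⟩
  one_mul := by
    rintro γ _ ⟨a, ha, rfl⟩
    exact congrArg MulOpposite.op (R.mul_one γ.inv ha)
  mul_one := by
    rintro γ _ ⟨a, ha, rfl⟩
    exact congrArg MulOpposite.op (R.one_mul γ.inv ha)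

theorem op_mem_comp {γ : GMor Γ} {a : R.carrier} :
    (MulOpposite.op a : R.op.carrier) ∈ R.op.comp γ ↔ a ∈ R.comp γ.inv := by
  constructor
  · rintro ⟨b, hb, h⟩
    exact MulOpposite.op_injective h ▸ hb
  · exact fun h => ⟨a, h, rfl⟩

/-- The additive isomorphism `R ≃ Rᵒᵖ`. -/
def toOp : R.carrier ≃+ R.op.carrier := MulOpposite.opAddEquiv

/-- Additive subgroups of `R` and of `Rᵒᵖ` correspond to each other. -/
def opSubgroup : AddSubgroup R.carrier ≃o AddSubgroup R.op.carrier :=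
  (MulOpposite.opAddEquiv (α := R.carrier)).mapAddSubgroup

theorem op_mem_opSubgroup {N : AddSubgroup R.carrier} {a : R.carrier} :
    (MulOpposite.op a : R.op.carrier) ∈ R.opSubgroup N ↔ a ∈ N := by
  constructor
  · rintro ⟨b, hb, h⟩
    exact MulOpposite.op_injective h ▸ hb
  · exact fun h => ⟨a, h, rfl⟩

theorem opSubgroup_comp (γ : GMor Γ) : R.opSubgroup (R.comp γ) = R.op.comp γ.inv := by
  change _ = (R.comp γ.inv.inv).map _
  rw [GMor.inv_inv]
  rfl

theorem isGraded_opSubgroup {N : AddSubgroup R.carrier} :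
    R.op.IsGraded (R.opSubgroup N) ↔ R.IsGraded N := by
  unfold IsGraded
  rw [← Function.Surjective.iSup_comp (g := fun γ => R.opSubgroup N ⊓ R.op.comp γ)
    (fun γ : GMor Γ => ⟨γ.inv, γ.inv_inv⟩)]
  simp only [← opSubgroup_comp, ← OrderIso.map_inf, ← OrderIso.map_iSup]
  exact R.opSubgroup.injective.eq_iff

theorem isGrRightIdeal_opSubgroup {N : AddSubgroup R.carrier} :
    R.op.IsGrRightIdeal (R.opSubgroup N) ↔ R.IsGrLeftIdeal N := by
  constructor
  · intro h
    exact ⟨R.isGraded_opSubgroup.1 h.graded, fun x hx a => R.op_mem_opSubgroup.1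
      (h.mul_mem_right _ (R.op_mem_opSubgroup.2 hx) (MulOpposite.op a))⟩
  · intro h
    refine ⟨R.isGraded_opSubgroup.2 h.graded, ?_⟩
    rintro _ ⟨x, hx, rfl⟩ a
    exact ⟨a.unop * x, h.mul_mem_left x hx a.unop, rfl⟩

theorem isGrLeftIdeal_opSubgroup {N : AddSubgroup R.carrier} :
    R.op.IsGrLeftIdeal (R.opSubgroup N) ↔ R.IsGrRightIdeal N := by
  constructor
  · intro h
    exact ⟨R.isGraded_opSubgroup.1 h.graded, fun x hx a => R.op_mem_opSubgroup.1
      (h.mul_mem_left _ (R.op_mem_opSubgroup.2 hx) (MulOpposite.op a))⟩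
  · intro h
    refine ⟨R.isGraded_opSubgroup.2 h.graded, ?_⟩
    rintro _ ⟨x, hx, rfl⟩ a
    exact ⟨x * a.unop, h.mul_mem_right x hx a.unop, rfl⟩

theorem isGrSimpleRight_opSubgroup {N : AddSubgroup R.carrier} :
    R.op.IsGrSimpleRight (R.opSubgroup N) ↔ R.IsGrSimpleLeft N := by
  unfold IsGrSimpleRight IsGrSimpleLeft
  rw [isGrRightIdeal_opSubgroup, ← R.opSubgroup.forall_congr_right (q := fun M =>
    M ≤ R.opSubgroup N → R.op.IsGrRightIdeal M → M = ⊥ ∨ M = R.opSubgroup N)]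
  simp [isGrRightIdeal_opSubgroup]

theorem isRightGrSemisimple_op : R.op.IsRightGrSemisimple ↔ R.IsLeftGrSemisimple := by
  unfold IsRightGrSemisimple IsLeftGrSemisimple
  constructor
  · rintro ⟨𝒮, h, h1⟩
    refine ⟨R.opSubgroup ⁻¹' 𝒮, fun S hS => R.isGrSimpleRight_opSubgroup.1 (h _ hS), ?_⟩
    apply R.opSubgroup.injective
    rw [OrderIso.map_sSup, ← sSup_image, Set.image_preimage_eq _ R.opSubgroup.surjective, h1,
      map_top]
  · rintro ⟨𝒮, h, h1⟩
    refine ⟨R.opSubgroup '' 𝒮, ?_, ?_⟩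
    · rintro _ ⟨S, hS, rfl⟩
      exact R.isGrSimpleRight_opSubgroup.2 (h _ hS)
    · rw [sSup_image, ← OrderIso.map_sSup, h1, map_top]

theorem isGrSimple_op (h : R.IsGrSimple) : R.op.IsGrSimple := by
  refine ⟨@MulOpposite.instNontrivial _ h.1, fun I hI => ?_⟩
  obtain ⟨N, rfl⟩ := R.opSubgroup.surjective I
  refine (h.2 N ⟨R.isGrLeftIdeal_opSubgroup.1 hI.2, R.isGrRightIdeal_opSubgroup.1 hI.1⟩).imp ?_ ?_
    <;> rintro rfl <;> simp

theorem opSubgroup_leftPart (e : Γ) : R.opSubgroup (R.leftPart e) = R.op.rightPart e := by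
  unfold leftPart rightPart
  rw [← Function.Surjective.iSup_comp
    (g := fun γ => ⨆ (_ : γ.r = e), R.op.comp γ) (fun γ : GMor Γ => ⟨γ.inv, γ.inv_inv⟩)]
  simp only [OrderIso.map_iSup, opSubgroup_comp, GMor.inv_r]

theorem isRightArtinian_op : R.op.IsRightArtinian ↔ R.IsLeftArtinian := by
  constructor
  · intro h e N hN hN'
    obtain ⟨n, hn⟩ := h e (fun n => R.opSubgroup (N n))
      (fun a b hab => R.opSubgroup.monotone (hN hab)) fun n =>
        ⟨R.isGrRightIdeal_opSubgroup.2 (hN' n).1, by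
          rw [← opSubgroup_leftPart]; exact R.opSubgroup.monotone (hN' n).2⟩
    exact ⟨n, fun m hm => R.opSubgroup.injective (hn m hm)⟩
  · intro h e N hN hN'
    obtain ⟨n, hn⟩ := h e (fun n => R.opSubgroup.symm (N n))
      (fun a b hab => R.opSubgroup.symm.monotone (hN hab)) fun n =>
        ⟨R.isGrRightIdeal_opSubgroup.1 (by simpa using (hN' n).1), by
          rw [OrderIso.symm_apply_le, opSubgroup_leftPart]
          exact (hN' n).2⟩
    exact ⟨n, fun m hm => R.opSubgroup.symm.injective (hn m hm)⟩

/-! ### Minimal homogeneous elements -/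

/-- A homogeneous element with this property is `0` or generates a gr-simple right ideal. -/
def RightMin (s : R.carrier) : Prop :=
  ∀ δ, ∀ a ∈ R.comp δ, s * a ≠ 0 → ∃ b ∈ R.comp δ.inv, s * a * b = s

/-- A homogeneous element with this property is `0` or generates a gr-simple left ideal. -/
def LeftMin (s : R.carrier) : Prop :=
  ∀ δ, ∀ a ∈ R.comp δ, a * s ≠ 0 → ∃ b ∈ R.comp δ.inv, b * (a * s) = s

/-- The homogeneous elements which are `0` or generate a gr-simple right ideal. -/
def rightMinSet : Set R.carrier := {s | (∃ γ, s ∈ R.comp γ) ∧ R.RightMin s}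

/-- `R` is additively generated by homogeneous elements which generate gr-simple right
ideals. -/
def IsRightMinSpanned : Prop := AddSubgroup.closure R.rightMinSet = ⊤

variable {R}

theorem RightMin.neg {s : R.carrier} (hs : R.RightMin s) : R.RightMin (-s) := by
  intro δ a ha h
  obtain ⟨b, hb, hab⟩ := hs δ a ha fun h0 => h (by rw [neg_mul, h0, neg_zero])
  exact ⟨b, hb, by rw [neg_mul, neg_mul, hab]⟩

/-- The element that returns `s * c` to `s` also returns `a * s * c` to `a * s`; homogeneity of `a`
plays no role. -/
theorem RightMin.mul_left {s : R.carrier} (hs : R.RightMin s) (a : R.carrier) :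
    R.RightMin (a * s) := by
  intro δ c hc h
  obtain ⟨b, hb, hab⟩ := hs δ c hc fun h0 => h (by rw [mul_assoc, h0, mul_zero])
  exact ⟨b, hb, by rw [mul_assoc a, mul_assoc a, hab]⟩

/-- If `b` returns `s * (a * c)` to `s`, then `b * a` returns `s * a * c` to `s * a`, and it has the
degree inverse to that of `c`. -/
theorem RightMin.mul_right {s : R.carrier} (hs : R.RightMin s) {δ : GMor Γ} {a : R.carrier}
    (ha : a ∈ R.comp δ) : R.RightMin (s * a) := by
  intro ε c hc h
  rw [mul_assoc] at h
  have hδ := composable_of_mul_ne_zero ha hc (right_ne_zero_of_mul h)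
  obtain ⟨δ⟩ := δ
  obtain ⟨ε⟩ := ε
  dsimp only at hδ
  subst hδ
  obtain ⟨b, hb, hab⟩ := hs _ _ (R.mul_mem δ ε ha hc) h
  refine ⟨b * a, ?_, by rw [mul_assoc s, ← mul_assoc, hab]⟩
  have := R.mul_mem _ _ hb ha
  simpa [GMor.inv] using this

theorem rightMin_op {s : R.carrier} : R.op.RightMin (MulOpposite.op s) ↔ R.LeftMin s := by
  constructor
  · intro h δ a ha h0
    obtain ⟨b, ⟨b, hb, rfl⟩, hab⟩ := h δ.inv (MulOpposite.op a)
      (R.op_mem_comp.2 (by rwa [GMor.inv_inv]))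
      fun h1 => h0 (MulOpposite.op_injective h1)
    rw [GMor.inv_inv] at hb
    exact ⟨b, hb, MulOpposite.op_injective hab⟩
  · rintro h δ _ ⟨a, ha, rfl⟩ h0
    obtain ⟨b, hb, hab⟩ := h δ.inv a ha fun h1 => h0 (congrArg MulOpposite.op h1)
    exact ⟨MulOpposite.op b, R.op_mem_comp.2 hb, congrArg MulOpposite.op hab⟩

/-- A homogeneous `a` equals `1_{r(γ)} * a`, and right multiplication by `a` carries right minimal
elements to right minimal elements. -/
theorem isRightMinSpanned_of_one_mem
    (h : ∀ e, R.one e ∈ AddSubgroup.closure R.rightMinSet) : R.IsRightMinSpanned := by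
  refine eq_top_iff.2 fun a _ => ?_
  induction a using R.homogeneous_induction with
  | mem γ a ha =>
    rw [← R.one_mul γ ha]
    have h1 := h γ.r
    generalize R.one γ.r = c at h1
    induction h1 using AddSubgroup.closure_induction with
    | mem s hs =>
      obtain ⟨⟨δ, hδ⟩, hs⟩ := hs
      exact AddSubgroup.subset_closure ⟨exists_mul_mem hδ ha, hs.mul_right ha⟩
    | zero => rw [zero_mul]; exact zero_mem _
    | add x y _ _ hx hy => rw [add_mul]; exact add_mem hx hy
    | neg x _ hx => rw [neg_mul]; exact neg_mem hx
  | zero => exact zero_mem _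
  | add x y hx hy => exact add_mem (hx trivial) (hy trivial)

/-! ### Semisimplicity through minimal elements -/

/-- The nonzero ideal `(s * a)R` lies in `S`, hence equals `S` and contains `s`. -/
theorem IsGrSimpleRight.rightMin {S : AddSubgroup R.carrier} (hS : R.IsGrSimpleRight S)
    {γ : GMor Γ} {s : R.carrier} (hs : s ∈ S) (hsγ : s ∈ R.comp γ) : R.RightMin s := by
  intro δ a ha h
  have hc := composable_of_mul_ne_zero hsγ ha h
  obtain ⟨γ⟩ := γ
  obtain ⟨δ⟩ := δ
  dsimp only at hc
  subst hc
  have hsa := R.mul_mem γ δ hsγ ha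
  have hle : (AddMonoidHom.mulLeft (s * a)).range ≤ S := by
    rintro _ ⟨b, rfl⟩
    exact hS.1.mul_mem_right _ (hS.1.mul_mem_right _ hs _) _
  rcases hS.2.2 _ hle (isGrRightIdeal_mulLeft_range hsa) with h0 | h1
  · have := mem_mulLeft_range_self hsa
    rw [h0] at this
    exact (h this).elim
  · rw [← h1] at hs
    obtain ⟨b, hb⟩ := hs
    change s * a * b = s at hb
    -- The factor `b` need not be homogeneous. Comparing components of degree `γ` in `s = s * a * b`
    -- leaves only its component of degree `δ⁻¹`.
    refine ⟨R.proj ⟨Groupoid.inv δ⟩ b, R.proj_mem _ _, ?_⟩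
    have := proj_mul_left (δ ≫ γ) γ hsa b
    rw [hb, proj_of_mem hsγ] at this
    conv_rhs => rw [this]
    simp

/-- A nonzero graded `N` inside `sR` contains a nonzero homogeneous element, which has the form `s *
b` with `b` homogeneous; minimality then brings `s` itself into `N`. -/
theorem RightMin.isGrSimpleRight {s : R.carrier} (hs : R.RightMin s) {γ : GMor Γ}
    (hsγ : s ∈ R.comp γ) (h0 : s ≠ 0) : R.IsGrSimpleRight (AddMonoidHom.mulLeft s).range := by
  refine ⟨isGrRightIdeal_mulLeft_range hsγ, fun h => h0 ?_, fun N hN hN' => ?_⟩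
  · have := mem_mulLeft_range_self hsγ
    rw [h] at this
    exact this
  · refine or_iff_not_imp_left.2 fun hne => le_antisymm hN ?_
    obtain ⟨ε, x, hx, hxN, hx0⟩ := hN'.graded.exists_ne_zero hne
    obtain ⟨z, hz⟩ := hN hxN
    obtain ⟨δ, b, hb, hxb⟩ := exists_proj_mul_left ε hsγ z
    change s * z = x at hz
    rw [hz, proj_of_mem hx] at hxb
    subst hxb
    obtain ⟨c, -, hc⟩ := hs δ b hb hx0
    rintro _ ⟨d, rfl⟩
    change s * d ∈ N
    rw [← hc]
    exact hN'.mul_mem_right _ (hN'.mul_mem_right _ hxN _) _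

theorem isRightMinSpanned_of_isRightGrSemisimple (h : R.IsRightGrSemisimple) :
    R.IsRightMinSpanned := by
  obtain ⟨𝒮, h𝒮, h⟩ := h
  refine eq_top_iff.2 (h ▸ sSup_le fun S hS => ?_)
  exact (h𝒮 S hS).1.graded.le_of_homogeneous fun γ a ha haS =>
    AddSubgroup.subset_closure ⟨⟨γ, ha⟩, (h𝒮 S hS).rightMin haS ha⟩

theorem IsRightMinSpanned.isRightGrSemisimple (h : R.IsRightMinSpanned) :
    R.IsRightGrSemisimple := by
  refine ⟨{S | R.IsGrSimpleRight S}, fun S hS => hS, ?_⟩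
  rw [eq_top_iff, ← h, AddSubgroup.closure_le]
  rintro s ⟨⟨γ, hγ⟩, hs⟩
  -- Zero counts as right minimal but generates no gr-simple ideal.
  by_cases h0 : s = 0
  · rw [h0]; exact zero_mem _
  · exact (le_sSup (show (AddMonoidHom.mulLeft s).range ∈ {S | R.IsGrSimpleRight S} from
      hs.isGrSimpleRight hγ h0)) (mem_mulLeft_range_self hγ)

/-! ### gr-simple artinian rings -/

/-- The minimal homogeneous elements additively generate a two-sided graded ideal. -/
theorem isGrIdeal_closure_rightMinSet :
    R.IsGrIdeal (AddSubgroup.closure R.rightMinSet) := by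
  have hg : R.IsGraded (AddSubgroup.closure R.rightMinSet) := by
    refine isGraded_of_proj_mem fun γ a ha => ?_
    induction ha using AddSubgroup.closure_induction with
    | mem s hs =>
      obtain ⟨δ, hδ⟩ := hs.1
      by_cases h : δ = γ
      · rw [← h, proj_of_mem hδ]
        exact AddSubgroup.subset_closure hs
      · rw [proj_of_mem_ne hδ h]; exact zero_mem _
    | zero => rw [map_zero]; exact zero_mem _
    | add x y _ _ hx hy => rw [map_add]; exact add_mem hx hy
    | neg x _ hx => rw [map_neg]; exact neg_mem hx
  refine ⟨⟨hg, fun x hx a => ?_⟩, ⟨hg, fun x hx a => ?_⟩⟩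
  · induction hx using AddSubgroup.closure_induction with
    | mem s hs =>
      obtain ⟨⟨δ, hδ⟩, hs⟩ := hs
      induction a using R.homogeneous_induction with
      | mem γ a ha =>
        exact AddSubgroup.subset_closure ⟨exists_mul_mem hδ ha, hs.mul_right ha⟩
      | zero => rw [mul_zero]; exact zero_mem _
      | add x y hx hy => rw [mul_add]; exact add_mem hx hy
    | zero => rw [zero_mul]; exact zero_mem _
    | add x y _ _ hx hy => rw [add_mul]; exact add_mem hx hy
    | neg x _ hx => rw [neg_mul]; exact neg_mem hx
  · induction hx using AddSubgroup.closure_induction with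
    | mem s hs =>
      obtain ⟨⟨δ, hδ⟩, hs⟩ := hs
      induction a using R.homogeneous_induction with
      | mem γ a ha =>
        exact AddSubgroup.subset_closure ⟨exists_mul_mem ha hδ, hs.mul_left a⟩
      | zero => rw [zero_mul]; exact zero_mem _
      | add x y hx hy => rw [add_mul]; exact add_mem hx hy
    | zero => rw [mul_zero]; exact zero_mem _
    | add x y _ _ hx hy => rw [mul_add]; exact add_mem hx hy
    | neg x _ hx => rw [mul_neg]; exact neg_mem hx

theorem exists_one_ne_zero (h : Nontrivial R.carrier) : ∃ e, R.one e ≠ 0 := by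
  by_contra! hc
  obtain ⟨a, ha⟩ := exists_ne (0 : R.carrier)
  refine ha ?_
  have h0 : ∀ b : R.carrier, b = 0 := by
    intro b
    induction b using R.homogeneous_induction with
    | mem γ b hb => rw [← R.one_mul γ hb, hc, zero_mul]
    | zero => rfl
    | add x y hx hy => rw [hx, hy, add_zero]
  exact h0 a

theorem mem_rightPart {γ : GMor Γ} {a : R.carrier} (ha : a ∈ R.comp γ) :
    a ∈ R.rightPart γ.r :=
  AddSubgroup.mem_iSup_of_mem γ (AddSubgroup.mem_iSup_of_mem rfl ha)

/-- The identity `1_e` fixes `R(e)` and annihilates every component whose codomain is not `e`. -/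
theorem eq_of_mem_rightPart {γ : GMor Γ} {e : Γ} {a : R.carrier} (ha : a ∈ R.comp γ)
    (h : a ∈ R.rightPart e) (h0 : a ≠ 0) : γ.r = e := by
  by_contra hne
  refine h0 ?_
  have h1 : ∀ b ∈ R.rightPart e, R.one e * b = b := by
    intro b hb
    have : R.rightPart e ≤ (AddMonoidHom.mulLeft (R.one e) - AddMonoidHom.id _).ker := by
      refine iSup₂_le fun δ hδ c hc => ?_
      rw [AddMonoidHom.mem_ker, AddMonoidHom.sub_apply, sub_eq_zero]
      exact hδ ▸ R.one_mul δ hc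
    simpa [AddMonoidHom.mem_ker, sub_eq_zero] using this hb
  rw [← h1 a h, one_mul_of_ne hne ha]

/-- Without a nonzero minimal element, every nonzero homogeneous `s` with codomain `e` has a nonzero
multiple `s * a` with `s ∉ (s * a)R`. Iterating from `1_e` gives a strictly descending chain of
principal right ideals in `R(e)`. -/
theorem IsRightArtinian.exists_rightMin (hA : R.IsRightArtinian) (h : Nontrivial R.carrier) :
    ∃ s ∈ R.rightMinSet, s ≠ 0 := by
  obtain ⟨e, he⟩ := exists_one_ne_zero h
  by_contra! hc
  let T := {s : R.carrier // s ≠ 0 ∧ ∃ γ : GMor Γ, γ.r = e ∧ s ∈ R.comp γ}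
  have step : ∀ s : T, ∃ t : T, (AddMonoidHom.mulLeft t.1).range ≤
      (AddMonoidHom.mulLeft s.1).range ∧ s.1 ∉ (AddMonoidHom.mulLeft t.1).range := by
    rintro ⟨s, h0, γ, hγ, hs⟩
    have hmin : ¬ R.RightMin s := fun hm => h0 (hc s ⟨⟨γ, hs⟩, hm⟩)
    unfold RightMin at hmin
    push Not at hmin
    obtain ⟨δ, a, ha, hsa, hmin⟩ := hmin
    have hcomp := composable_of_mul_ne_zero hs ha hsa
    obtain ⟨γ⟩ := γ
    obtain ⟨δ⟩ := δ
    dsimp only at hcomp hγ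
    subst hcomp hγ
    have hsa' := R.mul_mem γ δ hs ha
    refine ⟨⟨s * a, hsa, _, rfl, hsa'⟩, ?_, ?_⟩
    · rintro _ ⟨b, rfl⟩
      exact ⟨a * b, (mul_assoc _ _ _).symm⟩
    · rintro ⟨b, hb⟩
      change s * a * b = s at hb
      -- If `s` were in `(s * a)R`, the component of `b` of degree `δ⁻¹` would return `s * a` to
      -- `s`, which the choice of `a` excludes.
      refine hmin (R.proj ⟨Groupoid.inv δ⟩ b) (R.proj_mem _ _) ?_
      have := proj_mul_left (δ ≫ γ) γ hsa' b
      rw [hb, proj_of_mem hs] at this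
      conv_rhs => rw [this]
      simp
  choose f hf using step
  let x : ℕ → T := fun n => f^[n] ⟨R.one e, he, ⟨𝟙 e⟩, rfl, R.one_mem e⟩
  have hx : ∀ n, x (n + 1) = f (x n) := fun n => Function.iterate_succ_apply' f n _
  obtain ⟨n, hn⟩ := hA e (fun n => (AddMonoidHom.mulLeft (x n).1).range)
    (antitone_nat_of_succ_le fun n => by rw [hx]; exact (hf (x n)).1) fun n => by
      obtain ⟨γ, hγ, hs⟩ := (x n).2.2
      refine ⟨isGrRightIdeal_mulLeft_range hs,
        (isGrRightIdeal_mulLeft_range hs).graded.le_of_homogeneous fun δ a ha h => ?_⟩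
      by_cases h0 : a = 0
      · rw [h0]; exact zero_mem _
      obtain ⟨b, hb⟩ := h
      change (x n).1 * b = a at hb
      have hr : δ.r = γ.r := by
        by_contra hr
        have := proj_mul_left_of_ne hr hs b
        rw [hb, proj_of_mem ha] at this
        exact h0 this
      rw [← hγ, ← hr]
      exact mem_rightPart ha
  obtain ⟨γ, -, hs⟩ := (x n).2.2
  have := (hf (x n)).2
  rw [← hx] at this
  exact this (hn (n + 1) n.le_succ ▸ mem_mulLeft_range_self hs)

/-- The minimal elements generate a graded two-sided ideal; the chain condition makes it nonzero, so
gr-simplicity makes it all of `R`. -/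
theorem IsGrSimple.isRightMinSpanned (hs : R.IsGrSimple) (hA : R.IsRightArtinian) :
    R.IsRightMinSpanned := by
  refine (hs.2 _ isGrIdeal_closure_rightMinSet).resolve_left fun h => ?_
  obtain ⟨s, hs, h0⟩ := hA.exists_rightMin hs.1
  have := AddSubgroup.subset_closure (G := R.carrier) hs
  rw [h] at this
  exact h0 this

/-! ### Orthogonal idempotents -/

/-- A finite set of orthogonal homogeneous idempotents with sum `1_e` which generate gr-simple
right ideals. -/
structure IsIdemSystem (e : Γ) (U : Finset R.carrier) : Prop where
  mem : ∀ s ∈ U, s ∈ R.comp ⟨𝟙 e⟩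
  ne_zero : ∀ s ∈ U, s ≠ 0
  rightMin : ∀ s ∈ U, R.RightMin s
  idem : ∀ s ∈ U, s * s = s
  orth : ∀ s ∈ U, ∀ t ∈ U, s ≠ t → s * t = 0
  sum_eq : ∑ s ∈ U, s = R.one e

/-- Projecting to degree `𝟙 e` keeps or kills each homogeneous generator, so a sum of minimal
elements projects to a sum of minimal elements of `R_e`. -/
theorem IsRightMinSpanned.exists_sum_eq_one (h : R.IsRightMinSpanned) (e : Γ) :
    ∃ (n : ℕ) (s : Fin n → R.carrier),
      (∀ i, s i ∈ R.comp ⟨𝟙 e⟩ ∧ R.RightMin (s i)) ∧ ∑ i, s i = R.one e := by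
  have key : ∀ a ∈ AddSubgroup.closure R.rightMinSet, ∃ (n : ℕ) (s : Fin n → R.carrier),
      (∀ i, s i ∈ R.comp ⟨𝟙 e⟩ ∧ R.RightMin (s i)) ∧ ∑ i, s i = R.proj ⟨𝟙 e⟩ a := by
    intro a ha
    induction ha using AddSubgroup.closure_induction with
    | mem s hs =>
      obtain ⟨⟨γ, hγ⟩, hs⟩ := hs
      by_cases hγe : γ = ⟨𝟙 e⟩
      · subst hγe
        exact ⟨1, fun _ => s, fun _ => ⟨hγ, hs⟩, by simp [proj_of_mem hγ]⟩
      · exact ⟨0, Fin.elim0, fun i => i.elim0, by simp [proj_of_mem_ne hγ hγe]⟩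
    | zero => exact ⟨0, Fin.elim0, fun i => i.elim0, by simp⟩
    | add x y _ _ hx hy =>
      obtain ⟨n, s, hs, hx⟩ := hx
      obtain ⟨m, t, ht, hy⟩ := hy
      refine ⟨n + m, Fin.append s t, fun i => ?_, by simp [Fin.sum_univ_add, hx, hy]⟩
      induction i using Fin.addCases with
      | left i => simpa using hs i
      | right i => simpa using ht i
    | neg x _ hx =>
      obtain ⟨n, s, hs, hx⟩ := hx
      exact ⟨n, fun i => -s i, fun i => ⟨neg_mem (hs i).1, (hs i).2.neg⟩, by simp [hx]⟩
  obtain ⟨n, s, hs, h1⟩ := key (R.one e) (h ▸ trivial)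
  exact ⟨n, s, hs, h1.trans (proj_of_mem (R.one_mem e))⟩

/-- A shortest expression of `1_e` as a sum of minimal `s i` is independent: a relation `∑ s i * c i
= 0` normalised to `s k * c k = s k` would rewrite `1_e` as `∑ s i * (1_e - c i)`, where the `k`-th
term drops out. Comparing `∑ s j * s i = s i` with the trivial expression of `s i` then yields
orthogonal idempotents. -/
theorem IsRightMinSpanned.exists_isIdemSystem (h : R.IsRightMinSpanned) (e : Γ) :
    ∃ U : Finset R.carrier, R.IsIdemSystem e U := by
  classical
  have hex := h.exists_sum_eq_one e
  obtain ⟨s, hs, h1⟩ := Nat.find_spec hex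
  have hmin := fun m => Nat.find_min hex (m := m)
  generalize Nat.find hex = n at s hs h1 hmin
  have hone : ∀ i, R.one e * s i = s i := fun i => R.one_mul ⟨𝟙 e⟩ (hs i).1
  have hone' : ∀ i, s i * R.one e = s i := fun i => R.mul_one ⟨𝟙 e⟩ (hs i).1
  -- a linear dependence with a right invertible coefficient contradicts minimality
  have key : ∀ (k : Fin n) (c : Fin n → R.carrier), (∀ i, c i ∈ R.comp ⟨𝟙 e⟩) →
      s k * c k = s k → ∑ i, s i * c i ≠ 0 := by
    intro k c hc hk hsum
    obtain _ | n := n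
    · exact k.elim0
    refine hmin n n.lt_succ_self ⟨fun i => s (k.succAbove i) * (R.one e - c (k.succAbove i)),
      fun i => ⟨?_, ?_⟩, ?_⟩
    · exact mul_mem_of_mem_id_left (hs _).1 (sub_mem (R.one_mem e) (hc _))
    · exact (hs _).2.mul_right (sub_mem (R.one_mem e) (hc _))
    · have : ∑ i, s i * (R.one e - c i) = R.one e := by
        simp only [mul_sub, Finset.sum_sub_distrib, hsum, hone', h1, sub_zero]
      rw [Fin.sum_univ_succAbove _ k, mul_sub, hk, hone', sub_self, zero_add] at this
      exact this
  have hindep : ∀ c : Fin n → R.carrier, (∀ i, c i ∈ R.comp ⟨𝟙 e⟩) → ∑ i, s i * c i = 0 →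
      ∀ k, s k * c k = 0 := by
    intro c hc hsum k
    by_contra hk
    obtain ⟨b, hb, hkb⟩ := (hs k).2 _ _ (hc k) hk
    have hb' : b ∈ R.comp ⟨𝟙 e⟩ := by simpa [GMor.inv] using hb
    refine key k (fun i => c i * b) (fun i => mul_mem_of_mem_id_left (hc i) hb')
      (by rw [← mul_assoc, hkb]) ?_
    simp only [← mul_assoc, ← Finset.sum_mul, hsum, zero_mul]
  have hne : ∀ i, s i ≠ 0 := by
    intro k hk
    refine key k (fun i => 0) (fun i => zero_mem _) (by rw [mul_zero, hk]) (by simp)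
  have hprod : ∀ i j, s j * s i = if j = i then s i else 0 := by
    intro i j
    -- These coefficients form a relation because `∑ s j * s i - s i * 1_e = 1_e * s i - s i = 0`.
    have := hindep (fun j => s i - if j = i then R.one e else 0) (fun j => ?_) ?_ j
    · rw [mul_sub, sub_eq_zero] at this
      rw [this]
      split_ifs with hji
      · rw [hone', hji]
      · rw [mul_zero]
    · refine sub_mem (hs i).1 ?_
      split_ifs
      exacts [R.one_mem e, zero_mem _]
    · simp [mul_sub, Finset.sum_sub_distrib, ← Finset.sum_mul, h1, hone, hone']
  -- The system is a finset of values, so repeated values would change the sum.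
  have hinj : Function.Injective s := by
    intro i j hij
    by_contra hne'
    have h2 := hprod j i
    rw [if_neg hne', ← hij, hprod i i, if_pos rfl] at h2
    exact hne i h2
  refine ⟨Finset.univ.image s, ?_, ?_, ?_, ?_, ?_, ?_⟩
  · simpa using fun i => (hs i).1
  · simpa using hne
  · simpa using fun i => (hs i).2
  · simp [hprod]
  · simp only [Finset.mem_image, Finset.mem_univ, true_and]
    rintro _ ⟨i, rfl⟩ _ ⟨j, rfl⟩ hij
    rw [hprod, if_neg fun h => hij (congrArg s h)]
  · rw [Finset.sum_image fun i _ j _ h => hinj h, h1]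

theorem IsIdemSystem.exists_mul_ne_zero {e : Γ} {U : Finset R.carrier}
    (hU : R.IsIdemSystem e U) {a : R.carrier} (ha : R.one e * a ≠ 0) : ∃ s ∈ U, s * a ≠ 0 := by
  by_contra! hc
  refine ha ?_
  rw [← hU.sum_eq, Finset.sum_mul]
  exact Finset.sum_eq_zero hc

/-- An idempotent `v` at the codomain of `x` detects `x * u ≠ 0`. Then `v * x * u` lies between two
right minimal idempotents, and as in Schur's lemma its right inverse `u * y * v` is also a left
inverse, which returns `x * u` to `u`. -/
theorem IsRightMinSpanned.leftMin_of_idem (h : R.IsRightMinSpanned) {e : Γ} {u : R.carrier}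
    (hu : u ∈ R.comp ⟨𝟙 e⟩) (hidem : u * u = u) (hmin : R.RightMin u) : R.LeftMin u := by
  intro γ x hx hxu
  have hxu' : x * u ∈ R.comp γ := mul_mem_of_mem_id_right hx hu
  obtain ⟨U, hU⟩ := h.exists_isIdemSystem γ.r
  obtain ⟨v, hv, hvx⟩ := hU.exists_mul_ne_zero (a := x * u) (by rwa [R.one_mul γ hxu'])
  obtain ⟨y, hy, hvy⟩ := hU.rightMin v hv γ _ hxu' hvx
  have hyv : y * v ∈ R.comp γ.inv := mul_mem_of_mem_id_right hy (hU.mem v hv)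
  have hvv := hU.idem v hv
  have hv1 : v * (x * u) * (u * (y * v)) = v := by
    calc v * (x * u) * (u * (y * v)) = v * (x * (u * u)) * y * v := by simp only [mul_assoc]
      _ = v := by rw [hidem, hvy, hvv]
  -- Right minimality of `u` right inverts `u * y * v`, which already has the left inverse `v * x *
  -- u`; the identity `h2` is the usual comparison of the two.
  obtain ⟨z, hz, hyz⟩ := hmin _ _ hyv fun h0 => hU.ne_zero v hv (by
    rw [← hv1, h0, mul_zero])
  refine ⟨u * (y * v), mul_mem_of_mem_id_left hu hyv, ?_⟩
  have h2 : v * (x * u) = v * z := by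
    calc v * (x * u) = v * (x * u) * (u * (y * v) * z) := by
          rw [hyz, mul_assoc v, mul_assoc x, hidem]
      _ = v * (x * u) * (u * (y * v)) * z := by simp only [mul_assoc]
      _ = v * z := by rw [hv1]
  calc u * (y * v) * (x * u) = u * (y * (v * (x * u))) := by simp only [mul_assoc]
    _ = u * (y * v) * z := by rw [h2]; simp only [mul_assoc]
    _ = u := hyz

/-- Each `1_e` is a sum of idempotents that are minimal on both sides, and the local identities are
all that must be tested. -/
theorem IsRightMinSpanned.op (h : R.IsRightMinSpanned) : R.op.IsRightMinSpanned := by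
  refine isRightMinSpanned_of_one_mem fun e => ?_
  obtain ⟨U, hU⟩ := h.exists_isIdemSystem e
  change R.toOp (R.one e) ∈ _
  rw [← hU.sum_eq, map_sum]
  refine sum_mem fun s hs => AddSubgroup.subset_closure ⟨⟨(⟨𝟙 e⟩ : GMor Γ).inv, ?_⟩, ?_⟩
  · refine R.op_mem_comp.2 ?_
    rw [GMor.inv_inv]
    exact hU.mem s hs
  · exact rightMin_op.2 (h.leftMin_of_idem (hU.mem s hs) (hU.idem s hs) (hU.rightMin s hs))

/-- The mirror image of `op`; it is argued separately since `R.op.op` is only a copy of `R`. -/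
theorem IsRightMinSpanned.of_op (h : R.op.IsRightMinSpanned) : R.IsRightMinSpanned := by
  refine isRightMinSpanned_of_one_mem fun e => ?_
  obtain ⟨U, hU⟩ := h.exists_isIdemSystem e
  change R.toOp.symm (R.op.one e) ∈ _
  rw [← hU.sum_eq, map_sum]
  refine sum_mem fun s hs => AddSubgroup.subset_closure ⟨⟨(⟨𝟙 e⟩ : GMor Γ).inv, ?_⟩, ?_⟩
  · exact op_mem_comp R |>.1 (hU.mem s hs)
  · intro δ a ha h0
    have := h.leftMin_of_idem (hU.mem s hs) (hU.idem s hs) (hU.rightMin s hs)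
    obtain ⟨b, ⟨b, hb, rfl⟩, hab⟩ := this δ.inv (MulOpposite.op a)
      (R.op_mem_comp.2 (by rwa [GMor.inv_inv])) fun h1 => h0 (MulOpposite.op_injective h1)
    rw [GMor.inv_inv] at hb
    exact ⟨b, hb, MulOpposite.op_injective hab⟩

/-! ### The descending chain condition -/

/-- A finite-length argument for `∑ sR`, one `s` at a time. The sums over `U` with coefficients of a
common degree stand for the homogeneous elements of `∑ sR`, and the terms `s * a s` serve as
coordinates. -/
theorem exists_forall_mem_of_antitone {N : ℕ → AddSubgroup R.carrier} (hN : Antitone N)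
    (hN' : ∀ n, R.IsGrRightIdeal (N n)) (U : Finset R.carrier)
    (hU : ∀ s ∈ U, R.RightMin s) : ∃ n, ∀ m, n ≤ m → ∀ γ, ∀ a : R.carrier → R.carrier,
      (∀ s, a s ∈ R.comp γ) → ∑ s ∈ U, s * a s ∈ N n → ∑ s ∈ U, s * a s ∈ N m := by
  classical
  induction U using Finset.induction_on with
  | empty => exact ⟨0, fun m _ γ a _ _ => by simp⟩
  | insert s U hs ih =>
    obtain ⟨n, hn⟩ := ih fun s hs => hU s (Finset.mem_insert_of_mem hs)
    -- Either every `N k` has an element with nonzero `s`-coordinate, or from some `k` on this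
    -- coordinate vanishes identically.
    by_cases hB : ∀ k, ∃ γ, ∃ a : R.carrier → R.carrier, (∀ s, a s ∈ R.comp γ) ∧
      ∑ t ∈ insert s U, t * a t ∈ N k ∧ s * a s ≠ 0
    · refine ⟨n, fun m hm γ c hc h => ?_⟩
      obtain ⟨δ, a, ha, hak, has⟩ := hB m
      obtain ⟨b, hb, hab⟩ := hU s (Finset.mem_insert_self s U) δ (a s) (ha s) has
      have hy := (hN' m).mul_mem_right _ hak (b * c s)
      -- Minimality of `s` scales the chosen element of `N m` until its `s`-coordinate is `s * c s`;
      -- subtracting it leaves a sum over `U`, where the induction hypothesis applies.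
      have heq : ∑ t ∈ insert s U, t * c t =
          ∑ t ∈ U, t * (c t - a t * (b * c s)) +
            (∑ t ∈ insert s U, t * a t) * (b * c s) := by
        simp only [Finset.sum_insert hs, mul_sub, Finset.sum_sub_distrib, add_mul,
          Finset.sum_mul]
        rw [← mul_assoc (s * a s), hab]
        simp only [mul_assoc]
        abel
      rw [heq] at h ⊢
      refine add_mem (hn m hm γ _ (fun t => sub_mem (hc t) ?_) ?_) hy
      · rw [← mul_assoc]
        exact mul_mem_of_mem_id_left (mul_inv_mem (ha t) hb) (hc s)
      · exact (add_mem_cancel_right (hN hm hy)).1 h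
    · push Not at hB
      obtain ⟨k, hk⟩ := hB
      -- Past `k` the `s`-coordinate is zero, and past `n` the sums over `U` are stable.
      refine ⟨max n k, fun m hm γ c hc h => ?_⟩
      have h0 := hk γ c hc (hN (le_max_right n k) h)
      rw [Finset.sum_insert hs, h0, zero_add] at h ⊢
      exact hn m (le_trans (le_max_left _ _) hm) γ c hc (hN (le_max_left n k) h)

/-- Every homogeneous `a` in `R(e)` equals `∑ s * a` over an idempotent system at `e`, so the
preceding stabilisation applies with constant coefficients. -/
theorem IsRightMinSpanned.isRightArtinian (h : R.IsRightMinSpanned) : R.IsRightArtinian := by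
  intro e N hN hN'
  obtain ⟨U, hU⟩ := h.exists_isIdemSystem e
  obtain ⟨n, hn⟩ := exists_forall_mem_of_antitone hN (fun n => (hN' n).1) U hU.rightMin
  refine ⟨n, fun m hm => le_antisymm (hN hm) ?_⟩
  refine (hN' n).1.graded.le_of_homogeneous fun γ a ha haN => ?_
  by_cases h0 : a = 0
  · rw [h0]; exact zero_mem _
  have hr := eq_of_mem_rightPart ha ((hN' n).2 haN) h0
  have hsum : ∑ s ∈ U, s * a = a := by
    rw [← Finset.sum_mul, hU.sum_eq, ← hr, R.one_mul γ ha]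
  have := hn m hm γ (fun _ => a) (fun _ => ha)
  rw [hsum] at this
  exact this haN

theorem IsRightMinSpanned.isLeftArtinian (h : R.IsRightMinSpanned) : R.IsLeftArtinian :=
  R.isRightArtinian_op.1 h.op.isRightArtinian

end GrRing

/-! ### gr-isomorphisms -/

theorem proj_map {R S : GrRing.{u, v, w} Γ} (f : R.carrier →+ S.carrier)
    (hf : ∀ γ, ∀ a ∈ R.comp γ, f a ∈ S.comp γ) (δ : GMor Γ) (b : R.carrier) :
    S.proj δ (f b) = f (R.proj δ b) := by
  induction b using R.homogeneous_induction with
  | mem ε b hb =>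
    by_cases h : ε = δ
    · subst h
      rw [GrRing.proj_of_mem hb, GrRing.proj_of_mem (hf _ _ hb)]
    · rw [GrRing.proj_of_mem_ne hb h, GrRing.proj_of_mem_ne (hf _ _ hb) h, map_zero]
  | zero => simp
  | add x y hx hy => simp only [map_add, hx, hy]

/-- A degree-preserving map commutes with taking components, so an injective one also reflects
degrees. This makes the inverse of a gr-isomorphism graded. -/
theorem mem_comp_of_map_mem {R S : GrRing.{u, v, w} Γ} (f : R.carrier →+ S.carrier)
    (hf : ∀ γ, ∀ a ∈ R.comp γ, f a ∈ S.comp γ) (hinj : Function.Injective f) {γ : GMor Γ}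
    {a : R.carrier} (ha : f a ∈ S.comp γ) : a ∈ R.comp γ := by
  have := proj_map f hf γ a
  rw [GrRing.proj_of_mem ha] at this
  rw [hinj this]
  exact R.proj_mem _ _

theorem GrIso.isRightMinSpanned {R S : GrRing.{u, v, w} Γ} (h : GrIso R S)
    (hS : S.IsRightMinSpanned) : R.IsRightMinSpanned := by
  obtain ⟨φ, hφ, h1⟩ := h
  have hφ' : ∀ γ, ∀ a ∈ S.comp γ, φ.symm a ∈ R.comp γ := fun γ a ha =>
    mem_comp_of_map_mem (φ : R.carrier →+ S.carrier) hφ φ.injective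
      (show φ (φ.symm a) ∈ S.comp γ by rwa [φ.apply_symm_apply])
  refine GrRing.isRightMinSpanned_of_one_mem fun e => ?_
  have h2 : S.one e ∈ AddSubgroup.closure S.rightMinSet := hS ▸ trivial
  rw [← φ.symm_apply_apply (R.one e), h1]
  generalize S.one e = c at h2
  induction h2 using AddSubgroup.closure_induction with
  | mem s hs =>
    obtain ⟨⟨γ, hγ⟩, hs⟩ := hs
    refine AddSubgroup.subset_closure ⟨⟨γ, hφ' γ s hγ⟩, fun δ a ha h0 => ?_⟩
    obtain ⟨b, hb, hab⟩ := hs δ (φ a) (hφ δ a ha) fun h => h0 (φ.injective (by simpa using h))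
    exact ⟨φ.symm b, hφ' _ b hb, φ.injective (by simpa using hab)⟩
  | zero => rw [map_zero]; exact zero_mem _
  | add x y _ _ hx hy => rw [map_add]; exact add_mem hx hy
  | neg x _ hx => rw [map_neg]; exact neg_mem hx

/-- A ring homomorphism which is bijective on homogeneous components is a gr-isomorphism. -/
theorem GrIso.of_hom {R S : GrRing.{u, v, w} Γ} (f : R.carrier →ₙ+* S.carrier)
    (hf : ∀ γ, ∀ a ∈ R.comp γ, f a ∈ S.comp γ)
    (hinj : ∀ γ, ∀ a ∈ R.comp γ, f a = 0 → a = 0)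
    (hsurj : ∀ γ, ∀ b ∈ S.comp γ, ∃ a ∈ R.comp γ, f a = b) : GrIso R S := by
  have hbij : Function.Bijective f := by
    refine ⟨(injective_iff_map_eq_zero f).2 fun a ha => ?_, fun b => ?_⟩
    · refine GrRing.eq_zero_of_forall_proj_eq_zero fun γ => hinj γ _ (R.proj_mem γ a) ?_
      exact (proj_map (f : R.carrier →+ S.carrier) hf γ a).symm.trans
        ((congrArg _ ha).trans (map_zero _))
    · induction b using S.homogeneous_induction with
      | mem γ b hb =>
        obtain ⟨a, -, h⟩ := hsurj γ b hb
        exact ⟨a, h⟩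
      | zero => exact ⟨0, map_zero f⟩
      | add x y hx hy =>
        obtain ⟨a, rfl⟩ := hx
        obtain ⟨b, rfl⟩ := hy
        exact ⟨a + b, map_add f a b⟩
  refine ⟨RingEquiv.ofBijective f hbij, hf, fun e => ?_⟩
  change f (R.one e) = S.one e
  -- Identities are preserved automatically: with `f z = 1_e` one has `f 1_e = f 1_e * f z = f (1_e
  -- * z) = f z`.
  obtain ⟨z, hz, h⟩ := hsurj _ _ (S.one_mem e)
  calc f (R.one e) = f (R.one e) * S.one e := (S.mul_one ⟨𝟙 e⟩ (hf _ _ (R.one_mem e))).symm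
    _ = f (R.one e * z) := by rw [← h, map_mul]
    _ = S.one e := by rw [R.one_mul ⟨𝟙 e⟩ hz, h]

/-! ### Summable products -/

section Product

variable {J : Type w} (T : J → GrRing.{u, v, w} Γ)

/-- The projections of the graded direct product. -/
def grProdEval (j : J) : (grProd T).carrier →ₙ+* (T j).carrier :=
  (Pi.evalNonUnitalRingHom (fun j => (T j).carrier) j).comp (NonUnitalSubringClass.subtype _)

variable {T}

theorem grProd_ext {x y : (grProd T).carrier} (h : ∀ j, grProdEval T j x = grProdEval T j y) :
    x = y :=
  Subtype.ext (funext h)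

theorem grProd_mem_comp {γ : GMor Γ} {x : (grProd T).carrier} :
    x ∈ (grProd T).comp γ ↔ ∀ j, grProdEval T j x ∈ (T j).comp γ :=
  ⟨fun h j => h j trivial, fun h j _ => h j⟩

open Classical in
theorem pi_single_mem_prodComp {j : J} {γ : GMor Γ} {a : (T j).carrier}
    (ha : a ∈ (T j).comp γ) : (Pi.single j a : ∀ j, (T j).carrier) ∈ prodComp T γ := by
  intro k _
  by_cases h : k = j
  · subst h; simpa using ha
  · change (Pi.single j a : ∀ j, (T j).carrier) k ∈ (T k).comp γ
    rw [Pi.single_eq_of_ne h]; exact zero_mem _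

variable (T)

open Classical in
/-- The embedding of a factor into the graded direct product. -/
noncomputable def grProdSingle (j : J) : (T j).carrier →+ (grProd T).carrier where
  toFun a := ⟨Pi.single j a, by
    change (Pi.single j a : ∀ j, (T j).carrier) ∈ (⨆ γ, prodComp T γ)
    induction a using (T j).homogeneous_induction with
    | mem γ a ha => exact AddSubgroup.mem_iSup_of_mem γ (pi_single_mem_prodComp ha)
    | zero => rw [Pi.single_zero]; exact zero_mem _
    | add x y hx hy => rw [Pi.single_add]; exact add_mem hx hy⟩
  map_zero' := Subtype.ext (Pi.single_zero j)
  map_add' a b := grProd_ext fun k =>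
    congrFun (Pi.single_add (f := fun j => (T j).carrier) j a b) k

variable {T}

theorem grProdEval_single_same (j : J) (a : (T j).carrier) :
    grProdEval T j (grProdSingle T j a) = a := by
  classical
  exact Pi.single_eq_same (M := fun j => (T j).carrier) j a

theorem grProdEval_single_of_ne {j k : J} (h : k ≠ j) (a : (T j).carrier) :
    grProdEval T k (grProdSingle T j a) = 0 := by
  classical
  exact Pi.single_eq_of_ne (M := fun j => (T j).carrier) h a

theorem grProdSingle_mul (j : J) (a : (T j).carrier) (x : (grProd T).carrier) :
    grProdSingle T j a * x = grProdSingle T j (a * grProdEval T j x) := by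
  refine grProd_ext fun k => ?_
  rw [map_mul]
  by_cases h : k = j
  · subst h; rw [grProdEval_single_same, grProdEval_single_same]
  · rw [grProdEval_single_of_ne h, grProdEval_single_of_ne h, zero_mul]

theorem grProdSingle_mem {j : J} {γ : GMor Γ} {a : (T j).carrier} (ha : a ∈ (T j).comp γ) :
    grProdSingle T j a ∈ (grProd T).comp γ := by
  classical
  exact pi_single_mem_prodComp ha

/-- Multiplying an element of the factor `j` by `x` sees only the `j`-th coordinate of `x`, so
minimality can be checked inside that factor. -/
theorem grProdSingle_mem_rightMinSet {j : J} {s : (T j).carrier}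
    (hs : s ∈ (T j).rightMinSet) : grProdSingle T j s ∈ (grProd T).rightMinSet := by
  obtain ⟨⟨γ, hγ⟩, hs⟩ := hs
  refine ⟨⟨γ, grProdSingle_mem hγ⟩, fun δ a ha h0 => ?_⟩
  rw [grProdSingle_mul] at h0
  obtain ⟨b, hb, hab⟩ := hs δ _ (grProd_mem_comp.1 ha j) fun h => h0 (by rw [h, map_zero])
  refine ⟨grProdSingle T j b, grProdSingle_mem hb, ?_⟩
  rw [mul_assoc, grProdSingle_mul, map_mul (grProdEval T j), grProdEval_single_same, ← mul_assoc, hab]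

theorem grProdEval_sum_single {x : ∀ j, (T j).carrier} (hx : {j | x j ≠ 0}.Finite) (k : J) :
    grProdEval T k (∑ j ∈ hx.toFinset, grProdSingle T j (x j)) = x k := by
  rw [map_sum]
  by_cases hk : k ∈ hx.toFinset
  · rw [Finset.sum_eq_single_of_mem k hk fun j _ hj => grProdEval_single_of_ne hj.symm _,
      grProdEval_single_same]
  · rw [Finset.sum_eq_zero fun j hj =>
      grProdEval_single_of_ne (fun h => hk (by rwa [h])) _]
    by_contra h
    exact hk (hx.mem_toFinset.2 (Ne.symm h))

/-- Summability gives `1_e` of the product finite support, so it is a finite sum of the identities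
`1_e` of the factors. -/
theorem IsGrSummable.isRightMinSpanned (hsum : IsGrSummable T)
    (h : ∀ j, (T j).IsRightMinSpanned) : (grProd T).IsRightMinSpanned := by
  classical
  refine GrRing.isRightMinSpanned_of_one_mem fun e => ?_
  have hfin := (hsum ((grProd T).one e).1).1 ((grProd T).one e).2
  have hone : (grProd T).one e = ∑ j ∈ hfin.toFinset, grProdSingle T j ((T j).one e) := by
    exact grProd_ext fun k => (grProdEval_sum_single hfin k).symm
  rw [hone]
  refine sum_mem fun j _ => ?_
  have : (T j).one e ∈ AddSubgroup.closure (T j).rightMinSet := h j ▸ trivial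
  generalize (T j).one e = c at this
  induction this using AddSubgroup.closure_induction with
  | mem s hs => exact AddSubgroup.subset_closure (grProdSingle_mem_rightMinSet hs)
  | zero => rw [map_zero]; exact zero_mem _
  | add x y _ _ hx hy => rw [map_add]; exact add_mem hx hy
  | neg x _ hx => rw [map_neg]; exact neg_mem hx

end Product

/-! ### Elementary matrices -/

section FinMat

variable {I : Type*} {A : Type*} [NonUnitalRing A]

open Classical in
/-- The elementary matrices. -/
noncomputable def FinMat.single (i j : I) : A →+ FinMat I A where
  toFun a := ⟨fun k l => if k = i ∧ l = j then a else 0,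
    (Set.finite_singleton (i, j)).subset fun p hp => by
      by_contra h
      exact hp (if_neg fun h' => h (Set.mem_singleton_iff.2 (Prod.ext h'.1 h'.2)))⟩
  map_zero' := FinMat.ext fun k l => ite_self _
  map_add' a b := FinMat.ext fun k l => by
    change (if k = i ∧ l = j then a + b else 0) =
      (if k = i ∧ l = j then a else 0) + (if k = i ∧ l = j then b else 0)
    split_ifs
    · rfl
    · exact (add_zero 0).symm

open Classical in
theorem FinMat.entry_single (i j k l : I) (a : A) :
    FinMat.entry k l (FinMat.single i j a) = if k = i ∧ l = j then a else 0 := rfl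

open Classical in
theorem FinMat.entry_single_mul (i j k l : I) (a : A) (M : FinMat I A) :
    FinMat.entry k l (FinMat.single i j a * M) = if k = i then a * FinMat.entry j l M else 0 := by
  rw [FinMat.entry_mul, finsum_eq_single _ j]
  · rw [FinMat.entry_single]
    split_ifs <;> simp_all
  · intro m hm
    rw [FinMat.entry_single, if_neg fun h => hm h.2, zero_mul]

open Classical in
theorem FinMat.entry_mul_single (i j k l : I) (a : A) (M : FinMat I A) :
    FinMat.entry k l (M * FinMat.single i j a) = if l = j then FinMat.entry k i M * a else 0 := by
  rw [FinMat.entry_mul, finsum_eq_single _ i]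
  · rw [FinMat.entry_single]
    split_ifs <;> simp_all
  · intro m hm
    rw [FinMat.entry_single, if_neg fun h => hm h.1, mul_zero]

theorem FinMat.single_mul_mul_single (i j k l : I) (a b : A) (M : FinMat I A) :
    FinMat.single i j a * M * FinMat.single k l b =
      FinMat.single i l (a * FinMat.entry j k M * b) := by
  classical
  refine FinMat.ext fun p q => ?_
  rw [FinMat.entry_mul_single, FinMat.entry_single_mul, FinMat.entry_single]
  split_ifs <;> simp_all

theorem FinMat.exists_entry_ne_zero {M : FinMat I A} (h : M ≠ 0) :
    ∃ i j, FinMat.entry i j M ≠ 0 := by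
  by_contra! hc
  exact h (FinMat.ext fun i j => by rw [hc, map_zero])

end FinMat

/-! ### Graded matrix rings over gr-division rings -/

section Matrix

variable {D : GrRing.{u, v, w} Γ} {I : Type w} {S : I → Set (GMor Γ)}

theorem single_mem_matComp {γ : GMor Γ} {i j : I} {a : D.carrier}
    (ha : a ∈ sandwich D (S i) (S j) γ) : FinMat.single i j a ∈ matComp D S γ := by
  classical
  refine mem_matComp.2 fun k l => ?_
  rw [FinMat.entry_single]
  split_ifs with h
  · rw [h.1, h.2]; exact ha
  · exact zero_mem _

theorem idMat_eq_sum (hS : DFinite S) (e : Γ) :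
    idMat D S hS e = ∑ i ∈ (hS e).toFinset, FinMat.single i i (diagEntry D (S i) e) := by
  classical
  refine FinMat.ext fun k l => ?_
  simp only [map_sum, FinMat.entry_single]
  change (if k = l then diagEntry D (S k) e else 0) = _
  by_cases h : k = l
  · subst h
    rw [if_pos rfl, Finset.sum_eq_single k]
    · simp
    · intro i _ hi
      exact if_neg fun h => hi h.1.symm
    · intro h
      rw [if_pos ⟨rfl, rfl⟩]
      exact dif_neg (by simpa using h)
  · rw [if_neg h]
    refine (Finset.sum_eq_zero fun i _ => if_neg fun h' => h (h'.1.trans h'.2.symm)).symm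

theorem diagEntry_mul_self {T : Set (GMor Γ)} (e : Γ) :
    diagEntry D T e * diagEntry D T e = diagEntry D T e := by
  unfold diagEntry
  split_ifs
  · exact D.one_mul ⟨𝟙 _⟩ (D.one_mem _)
  · exact mul_zero _

/-- An entry of degree `σγτ⁻¹` has an inverse of degree `τγ⁻¹σ⁻¹`, which is what the transposed
position requires in component `γ⁻¹`. -/
theorem exists_inverse_of_mem_sandwich (hD : D.IsGrDivision) {T U : Set (GMor Γ)}
    (hT : DUnique T) (hU : DUnique U) {γ : GMor Γ} {a : D.carrier}
    (ha : a ∈ sandwich D T U γ) (h0 : a ≠ 0) :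
    ∃ b ∈ sandwich D U T γ.inv, a * b = diagEntry D T γ.r := by
  obtain ⟨x, y, σ, τ, hσ, hτ, ha⟩ := exists_of_mem_sandwich hT hU ha h0
  obtain ⟨b, hb, hab, -⟩ := hD.2 _ a ha h0
  refine ⟨b, comp_le_sandwich (γ := γ.inv) τ σ hτ hσ ?_, ?_⟩
  · simpa [GMor.inv] using hb
  · rw [hab, diagEntry_of_mem hT σ hσ]

variable (hS : IsMatricial D S)

/-- The underlying matrix of an element of the graded matrix ring. -/
noncomputable def grMatrixVal : (grMatrix D S hS).carrier →ₙ+* FinMat I D.carrier :=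
  NonUnitalSubringClass.subtype _

theorem grMatrixVal_injective : Function.Injective (grMatrixVal hS) := Subtype.val_injective

theorem grMatrix_mem_comp {γ : GMor Γ} {M : (grMatrix D S hS).carrier} :
    M ∈ (grMatrix D S hS).comp γ ↔ grMatrixVal hS M ∈ matComp D S γ := Iff.rfl

/-- A homogeneous matrix as an element of the graded matrix ring. -/
def grMatrixMk {γ : GMor Γ} {M : FinMat I D.carrier} (hM : M ∈ matComp D S γ) :
    (grMatrix D S hS).carrier :=
  ⟨M, (AddSubgroup.mem_iSup_of_mem γ hM : M ∈ (⨆ γ, matComp D S γ : AddSubgroup _))⟩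

@[simp] theorem grMatrixVal_mk {γ : GMor Γ} {M : FinMat I D.carrier}
    (hM : M ∈ matComp D S γ) : grMatrixVal hS (grMatrixMk hS hM) = M := rfl

theorem grMatrixMk_mem {γ : GMor Γ} {M : FinMat I D.carrier} (hM : M ∈ matComp D S γ) :
    grMatrixMk hS hM ∈ (grMatrix D S hS).comp γ := hM

/-- Multiplying `M` by the diagonal idempotent cuts out its `i`-th row. A nonzero entry in column
`l` of that row is invertible, and its inverse placed at position `(l, i)` restores the idempotent.
-/
theorem grMatrix_rightMin (hD : D.IsGrDivision) (i : I) (e : Γ) :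
    grMatrixMk hS (single_mem_matComp (diagEntry_mem (hS.dUnique i) e)) ∈
      (grMatrix D S hS).rightMinSet := by
  classical
  refine ⟨⟨⟨𝟙 e⟩, grMatrixMk_mem hS _⟩, fun δ M hM h0 => ?_⟩
  have hr : e = δ.r := GrRing.composable_of_mul_ne_zero (grMatrixMk_mem hS _) hM h0
  have h0' : FinMat.single i i (diagEntry D (S i) e) * grMatrixVal hS M ≠ 0 := fun h =>
    h0 (grMatrixVal_injective hS (by rw [map_mul, grMatrixVal_mk, h, map_zero]))
  obtain ⟨k, l, hkl⟩ := FinMat.exists_entry_ne_zero h0'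
  rw [FinMat.entry_single_mul] at hkl
  have hki : k = i := by
    by_contra h
    exact hkl (if_neg h)
  rw [if_pos hki] at hkl
  obtain ⟨b, hb, hMb⟩ := exists_inverse_of_mem_sandwich hD (hS.dUnique i) (hS.dUnique l)
    (mem_matComp.1 ((grMatrix_mem_comp hS).1 hM) i l) (right_ne_zero_of_mul hkl)
  refine ⟨grMatrixMk hS (single_mem_matComp hb), grMatrixMk_mem hS _,
    grMatrixVal_injective hS ?_⟩
  rw [map_mul, map_mul, grMatrixVal_mk, grMatrixVal_mk, FinMat.single_mul_mul_single, mul_assoc,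
    hMb, ← hr, diagEntry_mul_self]

theorem grMatrix_one_eq_sum (e : Γ) : (grMatrix D S hS).one e =
    ∑ i ∈ (hS.dFinite e).toFinset,
      grMatrixMk hS (single_mem_matComp (diagEntry_mem (hS.dUnique i) e)) := by
  refine grMatrixVal_injective hS ?_
  rw [map_sum]
  exact idMat_eq_sum hS.dFinite e

theorem grMatrix_isRightMinSpanned (hD : D.IsGrDivision) :
    (grMatrix D S hS).IsRightMinSpanned := by
  refine GrRing.isRightMinSpanned_of_one_mem fun e => ?_
  rw [grMatrix_one_eq_sum]
  exact sum_mem fun i _ => AddSubgroup.subset_closure (grMatrix_rightMin hS hD i e)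

end Matrix

/-! ### gr-division rings supported in one isotropy group -/

/-- The degree is `σ⁻¹τ`, for which `σ(σ⁻¹τ)τ⁻¹ = 1_e`. Hence all matrix units with entry `1_e` are
homogeneous. -/
theorem one_mem_sandwich_singleton {D : GrRing.{u, v, w} Γ} {e : Γ} {σ τ : GMor Γ}
    (hσ : σ.r = e) (hτ : τ.r = e) :
    ∃ γ, D.one e ∈ sandwich D {σ} {τ} γ := by
  obtain ⟨σ⟩ := σ
  obtain ⟨τ⟩ := τ
  dsimp only at hσ hτ
  subst hσ hτ
  refine ⟨⟨τ ≫ Groupoid.inv σ⟩, comp_le_sandwich (γ := ⟨τ ≫ Groupoid.inv σ⟩) σ τ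
    (Set.mem_singleton _) (Set.mem_singleton _) ?_⟩
  have := D.one_mem (Γ := Γ)
  simpa using this _

theorem diagEntry_singleton {D : GrRing.{u, v, w} Γ} {σ : GMor Γ} :
    diagEntry D {σ} σ.d = D.one σ.r :=
  diagEntry_of_mem (by rintro _ rfl _ rfl _; rfl) σ.hom rfl

/-- Take a nonzero homogeneous matrix in the ideal with a nonzero entry at `(i, j)`. Matrix units
and the inverse of the entry turn it into every diagonal unit `E_kk`, because all `σ k` end at the
same object `e`. The local identities are finite sums of these units. -/
theorem grMatrix_isGrSimple {D : GrRing.{u, v, w} Γ} (hD : D.IsGrDivision) {e : Γ}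
    {I : Type w} {σ : I → GMor Γ} (hσ : ∀ i, (σ i).r = e)
    (hS : IsMatricial D fun i => ({σ i} : Set (GMor Γ))) :
    (grMatrix D (fun i => {σ i}) hS).IsGrSimple := by
  classical
  set M := grMatrix D (fun i => {σ i}) hS
  constructor
  · obtain ⟨i⟩ := hS.nonempty_index
    refine ⟨⟨grMatrixMk hS (single_mem_matComp (diagEntry_mem (hS.dUnique i) (σ i).d)), 0,
      fun h => (hS.rUnique i).1 (σ i) rfl ?_⟩⟩
    have := congrArg (FinMat.entry i i) (congrArg Subtype.val h)
    change FinMat.entry i i (FinMat.single i i _) = 0 at this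
    rwa [FinMat.entry_single, if_pos ⟨rfl, rfl⟩, diagEntry_singleton] at this
  · intro N hN
    refine or_iff_not_imp_left.2 fun hne => ?_
    obtain ⟨γ, ⟨A, hA'⟩, hA, hAN, hA0⟩ := hN.1.graded.exists_ne_zero hne
    change A ∈ matComp D _ γ at hA
    obtain ⟨i, j, hij⟩ := FinMat.exists_entry_ne_zero (M := A) fun h => hA0 (Subtype.ext h)
    obtain ⟨b, hb, hAb⟩ := exists_inverse_of_mem_sandwich hD (hS.dUnique i) (hS.dUnique j)
      (mem_matComp.1 hA i j) hij
    -- A nonzero entry in row `i` of a matrix of degree `γ` forces `d(σ i) = r(γ)`.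
    have hd : diagEntry D {σ i} γ.r = D.one e := by
      by_cases h : (σ i).d = γ.r
      · rw [← h, diagEntry_singleton, hσ]
      · exfalso
        obtain ⟨x, y, s, t, hs, ht, -⟩ := exists_of_mem_sandwich (hS.dUnique i)
          (hS.dUnique j) (mem_matComp.1 hA i j) hij
        exact h (congrArg GMor.d hs).symm
    have hone : D.one e * D.one e = D.one e := D.one_mul ⟨𝟙 e⟩ (D.one_mem e)
    have hk : ∀ k, ∀ c : M.carrier, c.1 = FinMat.single k k (D.one e) → c ∈ N := by
      intro k c hc
      obtain ⟨γ₁, h₁⟩ := one_mem_sandwich_singleton (D := D) (hσ k) (hσ i)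
      obtain ⟨γ₂, h₂⟩ := one_mem_sandwich_singleton (D := D) (hσ i) (hσ k)
      have := hN.1.mul_mem_right _ (hN.1.mul_mem_right _ (hN.2.mul_mem_left _ hAN
        (grMatrixMk hS (single_mem_matComp h₁))) (grMatrixMk hS (single_mem_matComp hb)))
        (grMatrixMk hS (single_mem_matComp h₂))
      convert this using 1
      refine Subtype.ext (hc.trans ?_)
      change _ = FinMat.single k i (D.one e) * A * FinMat.single j i b *
        FinMat.single i k (D.one e)
      rw [FinMat.single_mul_mul_single, mul_assoc, hAb, hd, hone]
      refine FinMat.ext fun p q => ?_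
      rw [FinMat.entry_mul_single, FinMat.entry_single, FinMat.entry_single]
      split_ifs <;> simp_all
    refine eq_top_iff.2 fun a _ => ?_
    induction a using M.homogeneous_induction with
    | mem δ a ha =>
      rw [← M.one_mul δ ha]
      refine hN.1.mul_mem_right _ ?_ _
      rw [grMatrix_one_eq_sum]
      refine sum_mem fun k hkδ => hk k _ ?_
      obtain ⟨_, rfl, hkδ⟩ := (Set.Finite.mem_toFinset _).1 hkδ
      change FinMat.single k k (diagEntry D {σ k} δ.r) = _
      rw [← hkδ, diagEntry_singleton, hσ]
    | zero => exact zero_mem _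
    | add x y hx hy => exact add_mem (hx trivial) (hy trivial)

/-- Nonzero homogeneous elements are invertible with degrees in `eΓe`, so every nonzero graded ideal
contains the idempotent `1_e ≠ 0`. -/
theorem GrRing.IsGrDivision.isGrPrime {D : GrRing.{u, v, w} Γ} (hD : D.IsGrDivision) {e : Γ}
    (hsupp : D.supp ⊆ {γ | γ.r = e ∧ γ.d = e}) : D.IsGrPrime := by
  have key : ∀ N, D.IsGrIdeal N → N ≠ ⊥ → D.one e ∈ N ∧ D.one e ≠ 0 := by
    intro N hN hne
    obtain ⟨γ, a, ha, haN, h0⟩ := hN.1.graded.exists_ne_zero hne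
    have hγ : γ.r = e := (hsupp (show γ ∈ D.supp from fun h => by
      rw [h] at ha; exact h0 ha)).1
    obtain ⟨b, -, hab, -⟩ := hD.2 γ a ha h0
    subst hγ
    exact ⟨hab ▸ hN.1.mul_mem_right _ haN b, fun h => h0 (by rw [← D.one_mul γ ha, h, zero_mul])⟩
  intro N N' hN hN' hne hne'
  refine ⟨_, (key N hN hne).1, _, (key N' hN' hne').1, ?_⟩
  rw [D.one_mul ⟨𝟙 e⟩ (D.one_mem e)]
  exact (key N hN hne).2

/-! ### Corner rings -/

section Corner

variable {R : GrRing.{u, v, w} Γ} {e : Γ} {u : R.carrier}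

/-- The homogeneous components of the corner `uRu`. -/
def cornerComp (u : R.carrier) (γ : GMor Γ) : AddSubgroup R.carrier :=
  R.comp γ ⊓ (AddMonoidHom.mulLeft u - AddMonoidHom.id _).ker ⊓
    (AddMonoidHom.mulRight u - AddMonoidHom.id _).ker

theorem mem_cornerComp {γ : GMor Γ} {a : R.carrier} :
    a ∈ cornerComp u γ ↔ a ∈ R.comp γ ∧ u * a = a ∧ a * u = a := by
  simp only [cornerComp, AddSubgroup.mem_inf, AddMonoidHom.mem_ker, AddMonoidHom.sub_apply,
    sub_eq_zero, and_assoc]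
  rfl

theorem range_eq_of_mem_cornerComp (hu : u ∈ R.comp ⟨𝟙 e⟩) {γ : GMor Γ} {a : R.carrier}
    (ha : a ∈ cornerComp u γ)
    (h0 : a ≠ 0) : γ.r = e ∧ γ.d = e := by
  obtain ⟨ha, h1, h2⟩ := mem_cornerComp.1 ha
  refine ⟨(GrRing.composable_of_mul_ne_zero hu ha (by rwa [h1])).symm,
    GrRing.composable_of_mul_ne_zero ha hu (by rwa [h2])⟩

theorem mul_mul_mem_cornerComp (hu : u ∈ R.comp ⟨𝟙 e⟩) (hidem : u * u = u)
    {γ : GMor Γ} {a : R.carrier} (ha : a ∈ R.comp γ) :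
    u * a * u ∈ cornerComp u γ :=
  mem_cornerComp.2 ⟨GrRing.mul_mem_of_mem_id_right (GrRing.mul_mem_of_mem_id_left hu ha) hu,
    by rw [← mul_assoc, ← mul_assoc, hidem], by rw [mul_assoc, hidem]⟩

variable (hu : u ∈ R.comp ⟨𝟙 e⟩) (hidem : u * u = u)

open Classical in
/-- The corner ring `uRu` of a homogeneous idempotent `u ∈ R_e`. -/
noncomputable def corner : GrRing.{u, v, w} Γ :=
  GrRing.ofFamily R.carrier (cornerComp u)
    (R.indep.mono fun γ a ha => (mem_cornerComp.1 ha).1)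
    (fun γ δ a b ha hb => by
      rw [mem_cornerComp] at ha hb ⊢
      exact ⟨R.mul_mem γ δ ha.1 hb.1, by rw [← mul_assoc, ha.2.1], by rw [mul_assoc, hb.2.2]⟩)
    (fun γ δ a b h ha hb => R.mul_eq_zero γ δ h (mem_cornerComp.1 ha).1 (mem_cornerComp.1 hb).1)
    -- The corner is supported in `eΓe`, so its identity at any other object is zero.
    (fun f => if f = e then u else 0)
    (fun f => by
      split_ifs with h
      · subst h
        exact mem_cornerComp.2 ⟨hu, hidem, hidem⟩
      · exact zero_mem _)
    (fun γ a ha => by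
      by_cases h0 : a = 0
      · rw [h0, mul_zero]
      · rw [if_pos (range_eq_of_mem_cornerComp hu ha h0).1, (mem_cornerComp.1 ha).2.1])
    (fun γ a ha => by
      by_cases h0 : a = 0
      · rw [h0, zero_mul]
      · rw [if_pos (range_eq_of_mem_cornerComp hu ha h0).2, (mem_cornerComp.1 ha).2.2])

/-- The inclusion of the corner ring. -/
noncomputable def cornerVal : (corner hu hidem).carrier →ₙ+* R.carrier :=
  NonUnitalSubringClass.subtype _

theorem cornerVal_injective : Function.Injective (cornerVal hu hidem) := Subtype.val_injective

theorem corner_mem_comp {γ : GMor Γ} {a : (corner hu hidem).carrier} :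
    a ∈ (corner hu hidem).comp γ ↔ cornerVal hu hidem a ∈ R.comp γ ∧
      u * cornerVal hu hidem a = cornerVal hu hidem a ∧
      cornerVal hu hidem a * u = cornerVal hu hidem a :=
  mem_cornerComp

theorem cornerVal_one : cornerVal hu hidem ((corner hu hidem).one e) = u := by
  classical
  exact if_pos rfl

theorem cornerVal_mem (a : (corner hu hidem).carrier) :
    u * cornerVal hu hidem a = cornerVal hu hidem a ∧
      cornerVal hu hidem a * u = cornerVal hu hidem a := by
  induction a using (corner hu hidem).homogeneous_induction with
  | mem γ a ha => exact ((corner_mem_comp hu hidem).1 ha).2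
  | zero => simp
  | add x y hx hy => simp only [map_add, mul_add, add_mul, hx.1, hx.2, hy.1, hy.2, and_self]

/-- The map `a ↦ uau` onto the corner ring. -/
noncomputable def cornerMap : R.carrier →+ (corner hu hidem).carrier where
  toFun a := ⟨u * a * u, by
    change u * a * u ∈ (⨆ γ, cornerComp u γ : AddSubgroup _)
    induction a using R.homogeneous_induction with
    | mem γ a ha => exact AddSubgroup.mem_iSup_of_mem γ (mul_mul_mem_cornerComp hu hidem ha)
    | zero => rw [mul_zero, zero_mul]; exact zero_mem _
    | add x y hx hy => rw [mul_add, add_mul]; exact add_mem hx hy⟩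
  map_zero' := cornerVal_injective hu hidem
    ((congrArg (· * u) (mul_zero u)).trans (zero_mul u))
  map_add' a b := cornerVal_injective hu hidem
    ((congrArg (· * u) (mul_add u a b)).trans (add_mul _ _ u))

theorem cornerVal_map (a : R.carrier) :
    cornerVal hu hidem (cornerMap hu hidem a) = u * a * u := rfl

theorem cornerMap_mem {γ : GMor Γ} {a : R.carrier} (ha : a ∈ R.comp γ) :
    cornerMap hu hidem a ∈ (corner hu hidem).comp γ :=
  mul_mul_mem_cornerComp hu hidem ha

/-- A nonzero homogeneous element of `uRv` is invertible if `u` and `v` are minimal. -/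
theorem exists_inverse_of_rightMin {e f : Γ} {u v : R.carrier} (hu : u ∈ R.comp ⟨𝟙 e⟩)
    (hv : v ∈ R.comp ⟨𝟙 f⟩) (hu2 : u * u = u) (hv2 : v * v = v) (hu0 : u ≠ 0)
    (hu1 : R.RightMin u) (hv1 : R.RightMin v) {γ : GMor Γ} {a : R.carrier}
    (ha : a ∈ R.comp γ) (ha0 : a ≠ 0) (hua : u * a = a) (hav : a * v = a) :
    ∃ b ∈ R.comp γ.inv, v * b = b ∧ b * u = b ∧ a * b = u ∧ b * a = v := by
  obtain ⟨b, hb, hab⟩ := hu1 γ a ha (by rwa [hua])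
  rw [hua] at hab
  have hb' : v * b * u ∈ R.comp γ.inv :=
    GrRing.mul_mem_of_mem_id_right (GrRing.mul_mem_of_mem_id_left hv hb) hu
  have h1 : v * (v * b * u) = v * b * u := by rw [← mul_assoc, ← mul_assoc, hv2]
  have h2 : v * b * u * u = v * b * u := by rw [mul_assoc, hu2]
  have h3 : a * (v * b * u) = u := by rw [← mul_assoc, ← mul_assoc, hav, hab, hu2]
  obtain ⟨c, -, hc⟩ := hv1 _ _ hb' (by
    rw [h1]; intro h0; rw [h0, mul_zero] at h3; exact hu0 h3.symm)
  rw [h1] at hc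
  -- Here `v * b * u` has left inverse `a` and right inverse `c`; comparing them makes the one-sided
  -- inverse of `a` two-sided.
  have h4 : a = u * c := by
    calc a = a * v := hav.symm
      _ = a * (v * b * u) * c := by rw [mul_assoc, hc]
      _ = u * c := by rw [h3]
  refine ⟨_, hb', h1, h2, h3, ?_⟩
  conv_lhs => rw [h4]
  rw [← mul_assoc, h2, hc]

/-- Schur's lemma for the gr-simple right ideal `uR`: this is the case `v = u` of
`exists_inverse_of_rightMin`. -/
theorem corner_isGrDivision (h0 : u ≠ 0) (hmin : R.RightMin u) :
    (corner hu hidem).IsGrDivision := by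
  refine ⟨⟨(corner hu hidem).one e, 0, fun h => h0 ?_⟩, fun γ a ha ha0 => ?_⟩
  · rw [← cornerVal_one hu hidem, h, map_zero]
  · have hval0 : cornerVal hu hidem a ≠ 0 := fun h =>
      ha0 (cornerVal_injective hu hidem (by rw [h, map_zero]))
    have hrange := range_eq_of_mem_cornerComp hu
      (show cornerVal hu hidem a ∈ cornerComp u γ from ha) hval0
    obtain ⟨ha1, ha2, ha3⟩ := (corner_mem_comp hu hidem).1 ha
    obtain ⟨b, hb, h1, h2, h3, h4⟩ := exists_inverse_of_rightMin hu hu hidem hidem h0 hmin hmin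
      ha1 hval0 ha2 ha3
    have hbv : cornerVal hu hidem (cornerMap hu hidem b) = b := by rw [cornerVal_map, h1, h2]
    refine ⟨cornerMap hu hidem b, cornerMap_mem hu hidem hb, cornerVal_injective hu hidem ?_,
      cornerVal_injective hu hidem ?_⟩
    · rw [map_mul, hbv, h3, hrange.1, cornerVal_one]
    · rw [map_mul, hbv, h4, hrange.2, cornerVal_one]

theorem corner_supp : (corner hu hidem).supp ⊆ {γ | γ.r = e ∧ γ.d = e} := by
  intro γ hγ
  obtain ⟨⟨a, ha⟩, h0'⟩ := AddSubgroup.ne_bot_iff_exists_ne_zero.1 hγ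
  have h0 : a ≠ 0 := fun h => h0' (Subtype.ext h)
  exact range_eq_of_mem_cornerComp hu (show cornerVal hu hidem a ∈ cornerComp u γ from ha)
    fun h => h0 (cornerVal_injective hu hidem (by rw [h, map_zero]))

end Corner

/-! ### Frames -/

/-- A homogeneous idempotent `u ∈ R_e`, together with matrix units `p_k`, `q_k` which identify a
part of `R` with a graded matrix ring over `uRu`. -/
structure Frame (R : GrRing.{u, v, w} Γ) (K : Type w) where
  e : Γ
  u : R.carrier
  mem : u ∈ R.comp ⟨𝟙 e⟩
  idem : u * u = u
  σ : K → GMor Γ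
  r_eq : ∀ k, (σ k).r = e
  p : K → R.carrier
  q : K → R.carrier
  p_mem : ∀ k, p k ∈ R.comp (σ k)
  q_mem : ∀ k, q k ∈ R.comp (σ k).inv
  mul_p : ∀ k, u * p k = p k
  q_mul : ∀ k, q k * u = q k
  dFinite : DFinite fun k => ({σ k} : Set (GMor Γ))
  -- Between `a` and `b` the sum of the `q m * p m` acts as an identity; this is exactly
  -- multiplicativity of `a ↦ (p_k a q_l)`.
  complete : ∀ γ, ∀ a ∈ R.comp γ, ∀ b k l, p k * (a * b) * q l =
    ∑ m ∈ (dFinite γ.d).toFinset, p k * a * q m * (p m * b * q l)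

namespace Frame

variable {R : GrRing.{u, v, w} Γ} {K : Type w} (F : Frame R K)

/-- The corner ring of a frame. -/
noncomputable abbrev ring : GrRing.{u, v, w} Γ := corner F.mem F.idem

/-- The inclusion of the corner ring of a frame. -/
noncomputable abbrev val : F.ring.carrier →ₙ+* R.carrier := cornerVal F.mem F.idem

theorem mul_val (a : F.ring.carrier) : F.u * F.val a = F.val a := (cornerVal_mem _ _ a).1

theorem val_mul (a : F.ring.carrier) : F.val a * F.u = F.val a := (cornerVal_mem _ _ a).2

theorem composable_left {γ : GMor Γ} {a : R.carrier} (ha : a ∈ R.comp γ) {k : K}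
    (h : F.p k * a ≠ 0) : (F.σ k).d = γ.r :=
  GrRing.composable_of_mul_ne_zero (F.p_mem k) ha h

theorem composable_right {γ : GMor Γ} {a : R.carrier} (ha : a ∈ R.comp γ) {k : K}
    (h : a * F.q k ≠ 0) : (F.σ k).d = γ.d :=
  (GrRing.composable_of_mul_ne_zero ha (F.q_mem k) h).symm

/-- The entries `p_k a q_l` of the matrix of `a`. -/
noncomputable def coeff (k l : K) : R.carrier →+ F.ring.carrier :=
  (cornerMap F.mem F.idem).comp
    ((AddMonoidHom.mulRight (F.q l)).comp (AddMonoidHom.mulLeft (F.p k)))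

theorem val_coeff (k l : K) (a : R.carrier) : F.val (F.coeff k l a) = F.p k * a * F.q l := by
  change F.u * (F.p k * a * F.q l) * F.u = _
  rw [mul_assoc, mul_assoc, F.q_mul, ← mul_assoc, ← mul_assoc, F.mul_p]

/-- For `a` of degree `γ`, a nonzero entry needs `d(σ k) = r(γ)` and `d(σ l) = d(γ)`, and
`d`-finiteness leaves finitely many such pairs. -/
theorem finite_coeff_ne_zero (a : R.carrier) :
    {x : K × K | F.coeff x.1 x.2 a ≠ 0}.Finite := by
  induction a using R.homogeneous_induction with
  | mem γ a ha =>
    refine ((F.dFinite γ.r).prod (F.dFinite γ.d)).subset ?_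
    rintro ⟨k, l⟩ h
    have h' : F.p k * a * F.q l ≠ 0 := fun h0 => h (cornerVal_injective F.mem F.idem (by
      rw [map_zero]; exact (F.val_coeff k l a).trans h0))
    refine ⟨⟨_, rfl, F.composable_left ha (left_ne_zero_of_mul h')⟩,
      ⟨_, rfl, F.composable_right ha (k := l) fun h0 => h' ?_⟩⟩
    rw [mul_assoc, h0, mul_zero]
  | zero => simp
  | add x y hx hy =>
    refine (hx.union hy).subset fun z hz => ?_
    by_contra h
    simp only [Set.mem_union, Set.mem_ofPred_eq, not_or, not_not] at h
    exact hz (by rw [map_add, h.1, h.2, add_zero])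

/-- The matrix `(p_k a q_l)`, as an additive map. -/
noncomputable def matAddHom : R.carrier →+ FinMat K F.ring.carrier where
  toFun a := ⟨fun k l => F.coeff k l a, F.finite_coeff_ne_zero a⟩
  map_zero' := FinMat.ext fun k l => map_zero (F.coeff k l)
  map_add' a b := FinMat.ext fun k l => map_add (F.coeff k l) a b

theorem val_entry_matAddHom (k l : K) (a : R.carrier) :
    F.val (FinMat.entry k l (F.matAddHom a)) = F.p k * a * F.q l := F.val_coeff k l a

theorem matAddHom_mul (a b : R.carrier) :
    F.matAddHom (a * b) = F.matAddHom a * F.matAddHom b := by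
  induction a using R.homogeneous_induction with
  | mem γ a ha =>
    refine FinMat.ext fun k l => cornerVal_injective F.mem F.idem ?_
    rw [FinMat.entry_mul, finsum_eq_sum_of_support_subset (s := (F.dFinite γ.d).toFinset)]
    · refine (F.val_entry_matAddHom k l _).trans ?_
      rw [map_sum, F.complete γ a ha]
      refine Finset.sum_congr rfl fun m _ => ?_
      rw [map_mul]
      exact congrArg₂ _ (F.val_coeff k m a).symm (F.val_coeff m l b).symm
    · intro m hm
      have h := left_ne_zero_of_mul hm
      rw [Finset.mem_coe, Set.Finite.mem_toFinset]
      refine ⟨_, rfl, F.composable_right ha (k := m) fun h0 => h ?_⟩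
      refine cornerVal_injective F.mem F.idem ((F.val_entry_matAddHom k m a).trans ?_)
      rw [mul_assoc, h0, mul_zero, map_zero]
  | zero => rw [zero_mul, map_zero, zero_mul]
  | add x y hx hy => rw [add_mul, map_add, map_add, hx, hy, add_mul]

/-- The matrix `(p_k a q_l)`, as a ring homomorphism. -/
noncomputable def matHom : R.carrier →ₙ+* FinMat K F.ring.carrier :=
  { F.matAddHom with map_mul' := F.matAddHom_mul }

theorem val_entry_matHom (k l : K) (a : R.carrier) :
    F.val (FinMat.entry k l (F.matHom a)) = F.p k * a * F.q l := F.val_coeff k l a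

theorem dUnique (k : K) : DUnique ({F.σ k} : Set (GMor Γ)) := by
  rintro _ rfl _ rfl _
  rfl

theorem matHom_mem {γ : GMor Γ} {a : R.carrier} (ha : a ∈ R.comp γ) :
    F.matHom a ∈ matComp F.ring (fun k => {F.σ k}) γ := by
  refine mem_matComp.2 fun k l => ?_
  by_cases h0 : F.p k * a * F.q l = 0
  · have : FinMat.entry k l (F.matHom a) = 0 := cornerVal_injective F.mem F.idem
      (((F.val_entry_matHom k l a).trans h0).trans (map_zero _).symm)
    rw [this]; exact zero_mem _
  · have hk := F.composable_left ha (left_ne_zero_of_mul h0)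
    have hl := F.composable_right ha (k := l) fun h => h0 (by rw [mul_assoc, h, mul_zero])
    have hp := F.p_mem k
    have hq := F.q_mem l
    have hmem : ∀ δ, F.p k * a * F.q l ∈ R.comp δ →
        FinMat.entry k l (F.matHom a) ∈ F.ring.comp δ := by
      intro δ hδ
      refine (corner_mem_comp F.mem F.idem).2 ⟨?_, F.mul_val _, F.val_mul _⟩
      exact (F.val_entry_matHom k l a).symm ▸ hδ
    generalize F.σ k = σ at hk hp ⊢
    generalize F.σ l = τ at hl hq ⊢
    obtain ⟨σ⟩ := σ
    obtain ⟨τ⟩ := τ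
    obtain ⟨γ⟩ := γ
    dsimp only at hk hl
    subst hk hl
    have h1 := R.mul_mem _ (Groupoid.inv τ) (R.mul_mem σ γ hp ha) hq
    exact comp_le_sandwich (γ := ⟨γ⟩) σ τ (Set.mem_singleton _) (Set.mem_singleton _) (hmem _ h1)

theorem eq_of_mem_sandwich {k l : K} {γ : GMor Γ} {m : F.ring.carrier}
    (hm : m ∈ sandwich F.ring {F.σ k} {F.σ l} γ) (h0 : m ≠ 0) :
    (F.σ k).d = γ.r ∧ (F.σ l).d = γ.d := by
  obtain ⟨x, y, s, t, hs, ht, -⟩ := exists_of_mem_sandwich (F.dUnique k) (F.dUnique l) hm h0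
  exact ⟨(congrArg GMor.d hs).symm, (congrArg GMor.d ht).symm⟩

/-- The degree is `σ_k⁻¹(σ_kγσ_l⁻¹)σ_l = γ`. These products rebuild an element of `R` from its
matrix entries. -/
theorem mul_mul_mem {k l : K} {γ : GMor Γ} {m : F.ring.carrier}
    (hm : m ∈ sandwich F.ring {F.σ k} {F.σ l} γ) : F.q k * F.val m * F.p l ∈ R.comp γ := by
  by_cases h0 : m = 0
  · rw [h0, map_zero, mul_zero, zero_mul]; exact zero_mem _
  obtain ⟨x, y, s, t, hs, ht, hm⟩ := exists_of_mem_sandwich (F.dUnique k) (F.dUnique l) hm h0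
  have hm' := ((corner_mem_comp F.mem F.idem).1 hm).1
  have hp := F.p_mem l
  have hq := F.q_mem k
  rw [← Set.mem_singleton_iff.1 ht] at hp
  rw [← Set.mem_singleton_iff.1 hs] at hq
  have h1 := R.mul_mem (Groupoid.inv s) (Groupoid.inv t ≫ γ.hom ≫ s) hq hm'
  have h2 := R.mul_mem _ t h1 hp
  simpa using h2

end Frame

/-! ### Gluing homomorphisms to matrix rings -/

/-- Elements of finite support belong to the graded direct product. -/
theorem mem_iSup_prodComp_of_finite {J : Type w} {T : J → GrRing.{u, v, w} Γ}
    {x : ∀ j, (T j).carrier} (hx : {j | x j ≠ 0}.Finite) : x ∈ (⨆ γ, prodComp T γ) := by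
  have : x = (∑ j ∈ hx.toFinset, grProdSingle T j (x j)).1 :=
    funext fun k => (grProdEval_sum_single hx k).symm
  rw [this]
  exact (∑ j ∈ hx.toFinset, grProdSingle T j (x j)).2

/-- Elements of the graded product are finite sums of homogeneous ones, and one of degree `γ` lives
only on the finitely many factors whose component at `γ` is nonzero. -/
theorem isGrSummable_of_homogeneous {J : Type w} {T : J → GrRing.{u, v, w} Γ}
    (h : ∀ γ, {j | (T j).comp γ ≠ ⊥}.Finite) : IsGrSummable T := by
  refine fun x => ⟨fun hx => ?_, mem_iSup_prodComp_of_finite⟩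
  refine AddSubgroup.iSup_induction (prodComp T) (C := fun x => {j | x j ≠ 0}.Finite) hx
    (fun γ x hx => ?_) (by simp) (fun x y hx hy => ?_)
  · refine (h γ).subset fun j hj hbot => hj ?_
    have hxj : x j ∈ (T j).comp γ := hx j trivial
    rwa [hbot, AddSubgroup.mem_bot] at hxj
  · refine (hx.union hy).subset fun j hj => ?_
    by_contra hc
    simp only [Set.mem_union, Set.mem_ofPred_eq, not_or, not_not] at hc
    exact hj (by rw [Pi.add_apply, hc.1, hc.2, add_zero])

/-- A family of homomorphisms to matrix rings which is jointly bijective on homogeneous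
components is a gr-isomorphism to the graded direct product. -/
theorem grIso_grProd_grMatrix {R : GrRing.{u, v, w} Γ} {J : Type w}
    {D : J → GrRing.{u, v, w} Γ} {K : J → Type w} {S : ∀ j, K j → Set (GMor Γ)}
    (hS : ∀ j, IsMatricial (D j) (S j))
    (f : ∀ j, R.carrier →ₙ+* FinMat (K j) (D j).carrier)
    (hf : ∀ j γ, ∀ a ∈ R.comp γ, f j a ∈ matComp (D j) (S j) γ)
    (hinj : ∀ γ, ∀ a ∈ R.comp γ, (∀ j, f j a = 0) → a = 0)
    (hsurj : ∀ γ, ∀ M : ∀ j, FinMat (K j) (D j).carrier,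
      (∀ j, M j ∈ matComp (D j) (S j) γ) → ∃ a ∈ R.comp γ, ∀ j, f j a = M j) :
    GrIso R (grProd fun j => grMatrix (D j) (S j) (hS j)) := by
  have h1 : ∀ j a, f j a ∈ (⨆ γ, matComp (D j) (S j) γ : AddSubgroup _) := by
    intro j a
    induction a using R.homogeneous_induction with
    | mem γ a ha => exact AddSubgroup.mem_iSup_of_mem γ (hf j γ a ha)
    | zero => rw [map_zero]; exact zero_mem _
    | add x y hx hy => rw [map_add]; exact add_mem hx hy
  let g : ∀ j, R.carrier →ₙ+* (grMatrix (D j) (S j) (hS j)).carrier := fun j =>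
    { toFun := fun a => ⟨f j a, h1 j a⟩
      map_mul' := fun a b => grMatrixVal_injective (hS j) (map_mul (f j) a b)
      map_zero' := grMatrixVal_injective (hS j) (map_zero (f j))
      map_add' := fun a b => grMatrixVal_injective (hS j) (map_add (f j) a b) }
  have hg : ∀ j a, grMatrixVal (hS j) (g j a) = f j a := fun _ _ => rfl
  have h2 : ∀ a, (fun j => g j a) ∈
      (⨆ γ, prodComp (fun j => grMatrix (D j) (S j) (hS j)) γ : AddSubgroup _) := by
    intro a
    induction a using R.homogeneous_induction with
    | mem γ a ha => exact AddSubgroup.mem_iSup_of_mem γ fun j _ => hf j γ a ha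
    | zero =>
      simp only [map_zero]
      exact zero_mem _
    | add x y hx hy =>
      simp only [map_add]
      exact add_mem hx hy
  let F : R.carrier →ₙ+* (grProd fun j => grMatrix (D j) (S j) (hS j)).carrier :=
    { toFun := fun a => ⟨fun j => g j a, h2 a⟩
      map_mul' := fun a b => grProd_ext fun j => map_mul (g j) a b
      map_zero' := grProd_ext fun j => map_zero (g j)
      map_add' := fun a b => grProd_ext fun j => map_add (g j) a b }
  have hF : ∀ j a, grMatrixVal (hS j) (grProdEval _ j (F a)) = f j a := fun _ _ => rfl
  refine GrIso.of_hom F (fun γ a ha => grProd_mem_comp.2 fun j => ?_) (fun γ a ha h => ?_)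
    (fun γ b hb => ?_)
  · exact (grMatrix_mem_comp (hS j)).2 (hf j γ a ha)
  · refine hinj γ a ha fun j => ?_
    rw [← hF, h, map_zero, map_zero]
  · obtain ⟨a, ha, hab⟩ := hsurj γ (fun j => grMatrixVal (hS j) (grProdEval _ j b)) fun j =>
      (grMatrix_mem_comp (hS j)).1 (grProd_mem_comp.1 hb j)
    exact ⟨a, ha, grProd_ext fun j => grMatrixVal_injective (hS j) ((hF j a).trans (hab j))⟩

/-! ### Complete families of orthogonal idempotents -/

/-- A family of orthogonal homogeneous idempotents which generate gr-simple right ideals, with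
finitely many of them at each object, where they add up to the identity element. -/
structure IdemFamily (R : GrRing.{u, v, w} Γ) (X : Type w) where
  obj : X → Γ
  u : X → R.carrier
  fiber : Γ → Finset X
  mem_fiber : ∀ {e x}, x ∈ fiber e ↔ obj x = e
  mem : ∀ x, u x ∈ R.comp ⟨𝟙 (obj x)⟩
  ne_zero : ∀ x, u x ≠ 0
  rightMin : ∀ x, R.RightMin (u x)
  idem : ∀ x, u x * u x = u x
  orth : ∀ x y, x ≠ y → u x * u y = 0
  sum_eq : ∀ e, ∑ x ∈ fiber e, u x = R.one e

/-- The idempotents of all objects index themselves: a nonzero homogeneous element has only one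
degree, so each idempotent determines its object. -/
theorem GrRing.IsRightMinSpanned.exists_idemFamily {R : GrRing.{u, v, w} Γ}
    (h : R.IsRightMinSpanned) : ∃ X : Type w, Nonempty (IdemFamily R X) := by
  classical
  choose U hU using h.exists_isIdemSystem
  refine ⟨{a : R.carrier // ∃ e, a ∈ U e}, ⟨?_⟩⟩
  have hobj : ∀ (x : {a : R.carrier // ∃ e, a ∈ U e}) e, x.1 ∈ U e ↔ x.2.choose = e := by
    intro x e
    have hx := x.2.choose_spec
    refine ⟨fun he => ?_, fun he => he ▸ hx⟩
    exact congrArg GMor.d (GrRing.eq_of_mem_of_mem ((hU _).mem _ hx) ((hU e).mem _ he)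
      ((hU e).ne_zero _ he))
  exact {
    obj := fun x => x.2.choose
    u := fun x => x.1
    fiber := fun e => Finset.subtype _ (U e)
    mem_fiber := fun {e x} => by rw [Finset.mem_subtype, hobj]
    mem := fun x => (hU _).mem _ x.2.choose_spec
    ne_zero := fun x => (hU _).ne_zero _ x.2.choose_spec
    rightMin := fun x => (hU _).rightMin _ x.2.choose_spec
    idem := fun x => (hU _).idem _ x.2.choose_spec
    orth := fun x y hxy => by
      by_cases hd : x.2.choose = y.2.choose
      · refine (hU _).orth _ x.2.choose_spec _ ?_ fun h => hxy (Subtype.ext h)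
        rw [hd]
        exact y.2.choose_spec
      · exact R.mul_eq_zero ⟨𝟙 _⟩ ⟨𝟙 _⟩ hd ((hU _).mem _ x.2.choose_spec)
          ((hU _).mem _ y.2.choose_spec)
    sum_eq := fun e => by
      rw [Finset.sum_subtype_of_mem (fun a => a) fun a ha => ⟨e, ha⟩, (hU e).sum_eq] }

namespace IdemFamily

variable {R : GrRing.{u, v, w} Γ} {X : Type w} (F : IdemFamily R X)

/-- Two idempotents are connected if there is a nonzero homogeneous element between them. -/
def Connected (x y : X) : Prop :=
  ∃ γ, ∃ a ∈ R.comp γ, a ≠ 0 ∧ F.u x * a = a ∧ a * F.u y = a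

variable {F}

/-- By Schur's lemma a connecting element is invertible, so the right ideals of the two idempotents
are isomorphic up to a shift of degrees. Symmetry and transitivity of connectedness follow. -/
theorem Connected.exists_inverse {x y : X} (h : F.Connected x y) :
    ∃ γ : GMor Γ, γ.r = F.obj x ∧ γ.d = F.obj y ∧ ∃ a ∈ R.comp γ, ∃ b ∈ R.comp γ.inv,
      F.u x * a = a ∧ a * F.u y = a ∧ F.u y * b = b ∧ b * F.u x = b ∧
      a * b = F.u x ∧ b * a = F.u y := by
  obtain ⟨γ, a, ha, h0, h1, h2⟩ := h
  obtain ⟨b, hb, h3, h4, h5, h6⟩ := exists_inverse_of_rightMin (F.mem x) (F.mem y) (F.idem x)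
    (F.idem y) (F.ne_zero x) (F.rightMin x) (F.rightMin y) ha h0 h1 h2
  exact ⟨γ, (GrRing.composable_of_mul_ne_zero (F.mem x) ha (by rwa [h1])).symm,
    GrRing.composable_of_mul_ne_zero ha (F.mem y) (by rwa [h2]), a, ha, b, hb, h1, h2, h3, h4,
    h5, h6⟩

theorem Connected.refl (x : X) : F.Connected x x :=
  ⟨_, F.u x, F.mem x, F.ne_zero x, F.idem x, F.idem x⟩

theorem Connected.symm {x y : X} (h : F.Connected x y) : F.Connected y x := by
  obtain ⟨γ, -, -, a, ha, b, hb, -, -, h3, h4, h5, -⟩ := h.exists_inverse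
  exact ⟨γ.inv, b, hb, fun h0 => F.ne_zero x (by rw [← h5, h0, mul_zero]), h3, h4⟩

theorem Connected.trans {x y z : X} (h : F.Connected x y) (h' : F.Connected y z) :
    F.Connected x z := by
  obtain ⟨γ, -, -, a, ha, b, hb, h1, h2, h3, h4, h5, h6⟩ := h.exists_inverse
  obtain ⟨γ', -, -, a', ha', b', hb', h1', h2', h3', h4', h5', h6'⟩ := h'.exists_inverse
  obtain ⟨ε, hε⟩ := GrRing.exists_mul_mem ha ha'
  refine ⟨ε, a * a', hε, fun h0 => F.ne_zero x ?_, by rw [← mul_assoc, h1],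
    by rw [mul_assoc, h2']⟩
  calc F.u x = a * (a' * b') * b := by rw [h5', h2, h5]
    _ = a * a' * (b' * b) := by simp only [mul_assoc]
    _ = 0 := by rw [h0, zero_mul]

/-- Idempotents which are not connected annihilate each other. -/
theorem mul_mul_eq_zero_of_not_connected {x y : X} (h : ¬ F.Connected x y) (a : R.carrier) :
    F.u x * a * F.u y = 0 := by
  induction a using R.homogeneous_induction with
  | mem γ a ha =>
    by_contra h0
    exact h ⟨γ, _, GrRing.mul_mem_of_mem_id_right
      (GrRing.mul_mem_of_mem_id_left (F.mem x) ha) (F.mem y), h0,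
      by rw [← mul_assoc, ← mul_assoc, F.idem], by rw [mul_assoc, F.idem]⟩
  | zero => rw [mul_zero, zero_mul]
  | add a b ha hb => rw [mul_add, add_mul, ha, hb, add_zero]

variable (F)

/-- Connectedness as an equivalence relation. -/
def setoid : Setoid X where
  r := F.Connected
  iseqv := ⟨Connected.refl, Connected.symm, Connected.trans⟩

/-- The set of connected components. -/
abbrev Component : Type w := Quotient F.setoid

theorem connected_out (x : X) : F.Connected (Quotient.mk F.setoid x).out x :=
  Quotient.exact (s := F.setoid) (Quotient.out_eq _)

/-- The matrix unit from an idempotent to the representative of its component. -/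
theorem exists_matrixUnit : ∃ (σ : X → GMor Γ) (p q : X → R.carrier),
    ∀ x, (σ x).r = F.obj (Quotient.mk F.setoid x).out ∧ (σ x).d = F.obj x ∧
      p x ∈ R.comp (σ x) ∧ q x ∈ R.comp (σ x).inv ∧
      F.u (Quotient.mk F.setoid x).out * p x = p x ∧ p x * F.u x = p x ∧
      F.u x * q x = q x ∧ q x * F.u (Quotient.mk F.setoid x).out = q x ∧
      p x * q x = F.u (Quotient.mk F.setoid x).out ∧ q x * p x = F.u x := by
  have := fun x => (F.connected_out x).exists_inverse
  choose σ h1 h2 p hp q hq h using this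
  exact ⟨σ, p, q, fun x => ⟨h1 x, h2 x, hp x, hq x, h x⟩⟩

theorem sum_mul_eq {γ : GMor Γ} {a : R.carrier} (ha : a ∈ R.comp γ) :
    ∑ x ∈ F.fiber γ.r, F.u x * a = a := by
  rw [← Finset.sum_mul, F.sum_eq, R.one_mul γ ha]

theorem mul_sum_eq {γ : GMor Γ} {a : R.carrier} (ha : a ∈ R.comp γ) :
    ∑ x ∈ F.fiber γ.d, a * F.u x = a := by
  rw [← Finset.mul_sum, F.sum_eq, R.mul_one γ ha]

open Classical in
/-- The frames of the connected components. -/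
theorem exists_frames : ∃ f : ∀ j : F.Component,
    Frame R {x : X // Quotient.mk F.setoid x = j},
      (∀ j, (f j).u = F.u j.out) ∧
      (∀ j k, ((f j).σ k).d = F.obj k.1) ∧
      (∀ j k, (f j).p k * F.u k.1 = (f j).p k) ∧
      (∀ j k, F.u k.1 * (f j).q k = (f j).q k) ∧
      (∀ j k, (f j).p k * (f j).q k = (f j).u) ∧
      (∀ j k, (f j).q k * (f j).p k = F.u k.1) := by
  obtain ⟨σ, p, q, h⟩ := F.exists_matrixUnit
  choose hr hd hp hq hup hpu huq hqu hpq hqp using h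
  have hfin : ∀ j : F.Component, DFinite fun k : {x : X // Quotient.mk F.setoid x = j} =>
      ({σ k.1} : Set (GMor Γ)) := by
    intro j e
    refine Set.Finite.subset (Finset.finite_toSet (Finset.subtype _ (F.fiber e))) ?_
    rintro k ⟨_, rfl, hk⟩
    rw [Finset.mem_coe, Finset.mem_subtype, F.mem_fiber, ← hd, hk]
  refine ⟨fun j =>
    { e := F.obj j.out
      u := F.u j.out
      mem := F.mem _
      idem := F.idem _
      σ := fun k => σ k.1
      r_eq := fun k => by rw [hr, k.2]
      p := fun k => p k.1
      q := fun k => q k.1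
      p_mem := fun k => hp k.1
      q_mem := fun k => hq k.1
      mul_p := by rintro ⟨k, rfl⟩; exact hup k
      q_mul := by rintro ⟨k, rfl⟩; exact hqu k
      dFinite := hfin j
      complete := fun γ a ha b k l => ?_ }, fun j => rfl, fun j k => hd k.1, fun j k => hpu k.1,
    fun j k => huq k.1, by rintro j ⟨k, rfl⟩; exact hpq k, fun j k => hqp k.1⟩
  -- The identity `∑ u_x` at the domain of `γ` is inserted between `a` and `b`. Idempotents outside
  -- the component `j` drop out because `q l = u_l * q l`, and the remaining ones are rewritten as
  -- `q m * p m`.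
  calc p k.1 * (a * b) * q l.1 = ∑ x ∈ F.fiber γ.d, p k.1 * (a * F.u x * b) * q l.1 := by
        rw [← Finset.sum_mul, ← Finset.mul_sum, ← Finset.sum_mul, F.mul_sum_eq ha]
    _ = ∑ x ∈ F.fiber γ.d with Quotient.mk F.setoid x = j, p k.1 * (a * F.u x * b) * q l.1 := by
        refine (Finset.sum_filter_of_ne fun x _ h0 => ?_).symm
        by_contra hx
        have hc : ¬ F.Connected x l.1 := fun hc => hx ((Quotient.sound (s := F.setoid) hc).trans l.2)
        refine h0 ?_
        calc p k.1 * (a * F.u x * b) * q l.1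
            = p k.1 * a * (F.u x * b * F.u l.1) * q l.1 := by
              conv_lhs => rw [← huq l.1]
              simp only [mul_assoc]
          _ = 0 := by rw [mul_mul_eq_zero_of_not_connected hc, mul_zero, zero_mul]
    _ = ∑ m ∈ Finset.subtype (fun x => Quotient.mk F.setoid x = j) (F.fiber γ.d),
          p k.1 * (a * F.u m.1 * b) * q l.1 := by
        rw [← Finset.sum_subtype_eq_sum_filter]
    _ = ∑ m ∈ (hfin j γ.d).toFinset, p k.1 * a * q m.1 * (p m.1 * b * q l.1) := by
        refine Finset.sum_congr ?_ fun m _ => ?_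
        · ext m
          rw [Finset.mem_subtype, F.mem_fiber, Set.Finite.mem_toFinset]
          exact ⟨fun h => ⟨_, rfl, (hd m.1).trans h⟩, by rintro ⟨_, rfl, h⟩; exact (hd m.1) ▸ h⟩
        · rw [← hqp]
          simp only [mul_assoc]

end IdemFamily

/-- A ring generated by minimal homogeneous elements is a summable graded direct product of
graded matrix rings over gr-division rings. -/
theorem GrRing.IsRightMinSpanned.exists_grIso {R : GrRing.{u, v, w} Γ}
    (h : R.IsRightMinSpanned) :
    ∃ (J : Type w) (e : J → Γ) (D : J → GrRing.{u, v, w} Γ) (hD : ∀ j, (D j).IsGrDivision)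
        (hsupp : ∀ j, (D j).supp ⊆ {γ | γ.r = e j ∧ γ.d = e j})
        (K : J → Type w) (hK : ∀ j, Nonempty (K j)) (σ : ∀ j, K j → GMor Γ)
        (hσ : ∀ j k, (σ j k).r = e j)
        (hfin : ∀ j, DFinite fun k => ({σ j k} : Set (GMor Γ))),
        IsGrSummable (fun j => grMatrix (D j) (fun k => {σ j k})
          (isMatricial_singleton (hD j) (hsupp j) (hK j) (hσ j) (hfin j))) ∧
        GrIso R (grProd fun j => grMatrix (D j) (fun k => {σ j k})
          (isMatricial_singleton (hD j) (hsupp j) (hK j) (hσ j) (hfin j))) := by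
  classical
  obtain ⟨X, ⟨F⟩⟩ := h.exists_idemFamily
  obtain ⟨f, hu, hd, hpu, huq, hpq, hqp⟩ := F.exists_frames
  refine ⟨F.Component, fun j => (f j).e, fun j => (f j).ring,
    fun j => corner_isGrDivision _ _ (by rw [hu]; exact F.ne_zero _)
      (by rw [hu]; exact F.rightMin _), fun j => corner_supp _ _,
    fun j => {x : X // Quotient.mk F.setoid x = j}, fun j => ⟨⟨j.out, Quotient.out_eq j⟩⟩,
    fun j => (f j).σ, fun j => (f j).r_eq, fun j => (f j).dFinite,
    isGrSummable_of_homogeneous fun γ => ?_,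
    grIso_grProd_grMatrix _ (fun j => (f j).matHom) (fun j γ a ha => (f j).matHom_mem ha)
      (fun γ a ha h0 => ?_) (fun γ M hM => ?_)⟩
  -- Summability: a nonzero entry of degree `γ` in row `k` puts the idempotent `k` at the object
  -- `r(γ)`, which carries only finitely many idempotents.
  · refine ((F.fiber γ.r).finite_toSet.image (Quotient.mk F.setoid)).subset fun j hj => ?_
    obtain ⟨⟨M, hM⟩, h0⟩ := AddSubgroup.ne_bot_iff_exists_ne_zero.1 hj
    have hM' := (grMatrix_mem_comp _).1 hM
    obtain ⟨k, l, hkl⟩ := FinMat.exists_entry_ne_zero (M := grMatrixVal _ M) fun h =>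
      h0 (Subtype.ext (grMatrixVal_injective _ (h.trans (map_zero _).symm)))
    have := ((f j).eq_of_mem_sandwich (mem_matComp.1 hM' k l) hkl).1
    rw [hd] at this
    exact ⟨k.1, F.mem_fiber.2 this, k.2⟩
  -- Injectivity: `a` is the sum of its Peirce pieces `u_x a u_y`. For connected `x`, `y` the piece
  -- is `q_x (p_x a q_y) p_y`, determined by a matrix entry; otherwise it is zero.
  · rw [← F.sum_mul_eq ha]
    refine Finset.sum_eq_zero fun x _ => ?_
    rw [← F.mul_sum_eq (GrRing.mul_mem_of_mem_id_left (F.mem x) ha)]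
    refine Finset.sum_eq_zero fun y _ => ?_
    by_cases hc : F.Connected x y
    · have hxy : Quotient.mk F.setoid y = Quotient.mk F.setoid x :=
        Quotient.sound (s := F.setoid) hc.symm
      set j := Quotient.mk F.setoid x with hj
      have h1 := (f j).val_entry_matHom ⟨x, hj.symm⟩ ⟨y, hxy⟩ a
      rw [h0 j, map_zero, map_zero] at h1
      have h2 := hqp j ⟨x, hj.symm⟩
      have h3 := hqp j ⟨y, hxy⟩
      dsimp only at h2 h3
      rw [← h2, ← h3]
      calc _ = (f j).q ⟨x, hj.symm⟩ * ((f j).p ⟨x, hj.symm⟩ * a * (f j).q ⟨y, hxy⟩) *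
            (f j).p ⟨y, hxy⟩ := by simp only [mul_assoc]
        _ = 0 := by rw [← h1, mul_zero, zero_mul]
    · exact IdemFamily.mul_mul_eq_zero_of_not_connected hc a
  -- Surjectivity: `c x y` is the Peirce piece prescribed by the matrices, zero across different
  -- components, and the preimage is the sum of these pieces over the two fibers.
  · let c : X → X → R.carrier := fun x y =>
      if hxy : Quotient.mk F.setoid y = Quotient.mk F.setoid x then
        (f _).q ⟨x, rfl⟩ * (f _).val (FinMat.entry ⟨x, rfl⟩ ⟨y, hxy⟩ (M (Quotient.mk F.setoid x))) *
          (f _).p ⟨y, hxy⟩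
      else 0
    have hc : ∀ x y, F.u x * c x y = c x y ∧ c x y * F.u y = c x y := by
      intro x y
      by_cases hxy : Quotient.mk F.setoid y = Quotient.mk F.setoid x
      · simp only [c, dif_pos hxy]
        refine ⟨?_, ?_⟩
        · rw [← mul_assoc, ← mul_assoc]
          exact congrArg (· * _ * _) (huq _ ⟨x, rfl⟩)
        · rw [mul_assoc]
          exact congrArg (_ * ·) (hpu _ ⟨y, hxy⟩)
      · simp only [c, dif_neg hxy, mul_zero, zero_mul, and_self]
    have hcγ : ∀ x y, c x y ∈ R.comp γ := by
      intro x y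
      by_cases hxy : Quotient.mk F.setoid y = Quotient.mk F.setoid x
      · simp only [c, dif_pos hxy]
        exact (f _).mul_mul_mem (mem_matComp.1 (hM _) _ _)
      · simp only [c, dif_neg hxy]
        exact zero_mem _
    refine ⟨∑ x ∈ F.fiber γ.r, ∑ y ∈ F.fiber γ.d, c x y,
      sum_mem fun x _ => sum_mem fun y _ => hcγ x y, fun j => FinMat.ext ?_⟩
    rintro ⟨k, rfl⟩ ⟨l, hl⟩
    -- By orthogonality only the piece at `(k, l)` contributes to the entry at `(k, l)`.
    have hp : ∀ x y, (f (Quotient.mk F.setoid k)).p ⟨k, rfl⟩ * c x y * (f _).q ⟨l, hl⟩ =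
        if x = k ∧ y = l then
          (f _).val (FinMat.entry ⟨k, rfl⟩ ⟨l, hl⟩ (M (Quotient.mk F.setoid k))) else 0 := by
      intro x y
      by_cases hx : x = k
      · by_cases hy : y = l
        · subst hx hy
          rw [if_pos ⟨rfl, rfl⟩]
          simp only [c, dif_pos hl]
          calc _ = (f _).p ⟨x, rfl⟩ * (f _).q ⟨x, rfl⟩ * (f _).val (FinMat.entry ⟨x, rfl⟩ ⟨y, hl⟩
                (M (Quotient.mk F.setoid x))) * ((f _).p ⟨y, hl⟩ * (f _).q ⟨y, hl⟩) := by
                simp only [mul_assoc]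
            _ = _ := by rw [hpq, hpq, (f _).mul_val, (f _).val_mul]
        · rw [if_neg fun h => hy h.2, ← huq, ← (hc x y).2]
          calc _ = (f (Quotient.mk F.setoid k)).p ⟨k, rfl⟩ * c x y * (F.u y * F.u l) *
                (f _).q ⟨l, hl⟩ := by simp only [mul_assoc]
            _ = 0 := by rw [F.orth y l hy, mul_zero, zero_mul]
      · rw [if_neg fun h => hx h.1, ← hpu, ← (hc x y).1]
        calc _ = (f (Quotient.mk F.setoid k)).p ⟨k, rfl⟩ * (F.u k * F.u x) * c x y *
              (f _).q ⟨l, hl⟩ := by simp only [mul_assoc]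
          _ = 0 := by rw [F.orth k x (Ne.symm hx), mul_zero, zero_mul, zero_mul]
    refine cornerVal_injective _ _ (((f _).val_entry_matHom _ _ _).trans ?_)
    simp only [Finset.mul_sum, Finset.sum_mul, hp]
    -- A nonzero entry forces `k` and `l` into the fibers over `r(γ)` and `d(γ)`, so its piece does
    -- occur in the sum.
    by_cases hV : FinMat.entry ⟨k, rfl⟩ ⟨l, hl⟩ (M (Quotient.mk F.setoid k)) = 0
    · simp [hV]
    · obtain ⟨h1, h2⟩ := (f _).eq_of_mem_sandwich (mem_matComp.1 (hM _) _ _) hV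
      rw [hd] at h1 h2
      rw [Finset.sum_eq_single_of_mem k (F.mem_fiber.2 h1),
        Finset.sum_eq_single_of_mem l (F.mem_fiber.2 h2), if_pos ⟨rfl, rfl⟩]
      · exact fun y _ hy => if_neg fun h => hy h.2
      · exact fun x _ hx => Finset.sum_eq_zero fun y _ => if_neg fun h => hx h.1

end GroupoidGraded

/-! ### The equivalence of the six statements -/

theorem mainTheorem1 {Γ : Type u} [Groupoid.{v} Γ] (R : GrRing.{u, v, w} Γ) :
    List.TFAE [
      R.IsRightGrSemisimple,
      R.IsLeftGrSemisimple,
      ∃ (J : Type w) (e : J → Γ) (D : J → GrRing.{u, v, w} Γ) (hD : ∀ j, (D j).IsGrDivision)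
        (hsupp : ∀ j, (D j).supp ⊆ {γ | γ.r = e j ∧ γ.d = e j})
        (K : J → Type w) (hK : ∀ j, Nonempty (K j)) (σ : ∀ j, K j → GMor Γ)
        (hσ : ∀ j k, (σ j k).r = e j)
        (hfin : ∀ j, DFinite fun k => ({σ j k} : Set (GMor Γ))),
        IsGrSummable (fun j => grMatrix (D j) (fun k => {σ j k})
          (isMatricial_singleton (hD j) (hsupp j) (hK j) (hσ j) (hfin j))) ∧
        GrIso R (grProd fun j => grMatrix (D j) (fun k => {σ j k})
          (isMatricial_singleton (hD j) (hsupp j) (hK j) (hσ j) (hfin j))),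
      ∃ (J : Type w) (D : J → GrRing.{u, v, w} Γ) (K : J → Type w)
        (S : ∀ j, K j → Set (GMor Γ)) (hS : ∀ j, IsMatricial (D j) (S j)),
        (∀ j, (D j).IsGrDivision ∧ (D j).IsGrPrime) ∧
        IsGrSummable (fun j => grMatrix (D j) (S j) (hS j)) ∧
        GrIso R (grProd fun j => grMatrix (D j) (S j) (hS j)),
      ∃ (J : Type w) (T : J → GrRing.{u, v, w} Γ),
        (∀ j, (T j).IsGrSimple ∧ (T j).IsRightArtinian) ∧
        IsGrSummable T ∧ GrIso R (grProd T),
      ∃ (J : Type w) (T : J → GrRing.{u, v, w} Γ),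
        (∀ j, (T j).IsGrSimple ∧ (T j).IsLeftArtinian) ∧
        IsGrSummable T ∧ GrIso R (grProd T)] := by
  -- Every implication back to the first statement goes through spannedness, and the left-handed
  -- ones reach it by way of the opposite ring.
  have right_of_spanned : R.IsRightMinSpanned → R.IsRightGrSemisimple :=
    fun h => h.isRightGrSemisimple
  tfae_have 1 → 3 := fun h =>
    (GrRing.isRightMinSpanned_of_isRightGrSemisimple h).exists_grIso
  tfae_have 1 → 2 := fun h => R.isRightGrSemisimple_op.1
    (GrRing.isRightMinSpanned_of_isRightGrSemisimple h).op.isRightGrSemisimple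
  tfae_have 2 → 1 := fun h => right_of_spanned <| GrRing.IsRightMinSpanned.of_op <|
    GrRing.isRightMinSpanned_of_isRightGrSemisimple (R.isRightGrSemisimple_op.2 h)
  tfae_have 3 → 4 := by
    rintro ⟨J, e, D, hD, hsupp, K, hK, σ, hσ, hfin, h⟩
    exact ⟨J, D, K, _, _, fun j => ⟨hD j, (hD j).isGrPrime (hsupp j)⟩, h⟩
  tfae_have 3 → 5 := by
    rintro ⟨J, e, D, hD, hsupp, K, hK, σ, hσ, hfin, h⟩
    exact ⟨J, _, fun j => ⟨grMatrix_isGrSimple (hD j) (hσ j) _,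
      (grMatrix_isRightMinSpanned _ (hD j)).isRightArtinian⟩, h⟩
  tfae_have 3 → 6 := by
    rintro ⟨J, e, D, hD, hsupp, K, hK, σ, hσ, hfin, h⟩
    exact ⟨J, _, fun j => ⟨grMatrix_isGrSimple (hD j) (hσ j) _,
      (grMatrix_isRightMinSpanned _ (hD j)).isLeftArtinian⟩, h⟩
  tfae_have 4 → 1 := by
    rintro ⟨J, D, K, S, hS, hD, hsum, hiso⟩
    exact right_of_spanned <| hiso.isRightMinSpanned <| hsum.isRightMinSpanned fun j =>
      grMatrix_isRightMinSpanned _ (hD j).1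
  tfae_have 5 → 1 := by
    rintro ⟨J, T, hT, hsum, hiso⟩
    exact right_of_spanned <| hiso.isRightMinSpanned <| hsum.isRightMinSpanned fun j =>
      (hT j).1.isRightMinSpanned (hT j).2
  tfae_have 6 → 1 := by
    rintro ⟨J, T, hT, hsum, hiso⟩
    exact right_of_spanned <| hiso.isRightMinSpanned <| hsum.isRightMinSpanned fun j =>
      GrRing.IsRightMinSpanned.of_op <|
        ((T j).isGrSimple_op (hT j).1).isRightMinSpanned ((T j).isRightArtinian_op.2 (hT j).2)
  tfae_finish
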